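/- **Setting.** Let $K$ be a compact topological space (e.g. $K=\overline\Omega$ with $\Omega\subset\mathbb R^d$ bounded), $X=C(K,\mathbb C)$ with the maximum norm, $Y$ a complex Banach space, $T>0$. Let $A:D(A)\subset X\to X$ and $\partial:D(A)\to Y$ be linear, $f:[0,T]\times X\to X$, $g:[0,T]\to Y$, and let $u$ be a solution of $$u'(t)=Au(t)+f(t,u(t)),\quad u(0)=u_0,\quad \partial u(t)=g(t),\qquad 0\le t\le T .$$ Derivatives of $f$ are real Fréchet derivatives. Assume: - (A1) $\partial$ is onto. - (A2) $A_0=A|_{\ker\partial}$ generates a semigroup $(e^{tA_0})_{t\ge0}$ of bounded operators of negative type $\omega$: $e^{0A_0}=I$, $e^{(s+t)A_0}=e^{sA_0}e^{tA_0}$, the semigroup is strongly continuous for $t>0$, for each $\omega_1>\omega$ there is $M$ with $\|e^{tA_0}\|\le Me^{\omega_1t}$ for all $t\ge 0$, and $(z-A_0)^{-1}x=\int_0^\infty e^{-zt}e^{tA_0}x\,dt$ for $\Re z>\omega$, $x\in X$. (This holds for every $C_0$-semigroup and its generator; density of $\ker\partial$ in $X$ is not required.) - (A3) For $\Re z>0$,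 $v\in Y$ the problem $Ax=zx$, $\partial x=v$ has a unique solution $x\in D(A)$; and there are $\omega_0>\omega$ and $C$ such that $\|x\|\le C\|\partial x\|$ whenever $\Re z\ge\omega_0$, $x\in D(A)$, $Ax=zx$. - (A4) $f\in C^1([0,T]\times X,X)$, $g\in C^1([0,T],Y)$. - (A5) $u\in C^2([0,T],X)$, $u(t)\in D(A^2)$ for all $t$, and $Au,A^2u\in C^1([0,T],X)$. - (A6) $f(t,u(t))\in D(A)$ for all $t$, and $Af(\cdot,u(\cdot))\in C([0,T],X)$. **Space discretization.** A family of discretizations with mesh sizes $h>0$ is given. For each of them there are nodes $x_1,\dots,x_N\in K$; $P_hv=(v(x_i))_i\in\mathbb C^N$; $\mathbb C^N$ carries the maximum norm $\|\cdot\|$; and there are a matrix $A_{h,0}$, a linear operator $C_h:Y\to\mathbb C^N$, and $f:[0,T]\times\mathbb C^N\to\mathbb C^N$ of class $C^2$ with $P_hf(t,v)=f(t,P_hv)$ for $v\in X$. All constants below are independent of the discretization. Assume: - (H1) $\|e^{tA_{h,0}}\|\le1$ for $t\ge0$; $A_{h,0}$ is invertible and $\|A_{h,0}^{-1}\|\le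 C$. - (H2) There is a subspace $Z\subset D(A)$ with a norm $\|\cdot\|_Z$ such that, for $v\in Z$, $A_0^{-1}v\in Z$ and $e^{tA_0}v\in Z$ for $t\ge0$, and, with $R_hv:=A_{h,0}^{-1}(P_hAv-C_h\partial v)$, $$\|A_{h,0}(P_hv-R_hv)\|\le\varepsilon_h\|v\|_Z,\qquad \|P_hv-R_hv\|\le\eta_h\|v\|_Z,$$ where $\varepsilon_h,\eta_h\ge0$ tend to $0$ as $h\to0$. - (H3) There are $r,L>0$ such that $\|f_u(t,U)\|\le L$ for $t\in[0,T]$ and $U\in\mathbb C^N$ with $\|U-P_hu(t)\|\le r$. **Method.** Let $\Psi^{f,t}_\tau$ be a one-step integrator on $\mathbb C^N$ of order $p\ge2$ for $v'(s)=f(t+s,v(s))$: there are $r,\tau_0,C>0$ such that, for $0<\tau\le\tau_0$, $0\le t$, $t+\tau\le T$ and every solution $v$ on $[0,\tau]$ with $\|v(0)-P_hu(t)\|\le r$, one has $\|\Psi^{f,t}_\tau(v(0))-v(\tau)\|\le C\tau^{p+1}$. Put $\varphi_j(tM)=t^{-j}\int_0^te^{(t-\tau)M}\frac{\tau^{j-1}}{(j-1)!}\,d\tau$.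 For $k>0$, $t_n=nk$, the modified exponential Strang splitting is $U_h^0=P_hu_0$ and $$V_h^n=\Psi^{f,t_n}_{k/2}(U_h^n),$$ $$W_h^n=e^{kA_{h,0}}V_h^n+k\varphi_1(kA_{h,0})\Big[C_hg(t_n)+\frac k2C^*_{h,n}(U_h^n)\Big]+k^2\varphi_2(kA_{h,0})\big[C_hg'(t_n)-C^*_{h,n}(U_h^n)\big],$$ $$U_h^{n+1}=\Psi^{f,t_n+k/2}_{k/2}(W_h^n),$$ where $C^*_{h,n}(U)=C^*_h(t_n,U)$ for given maps $C^*_h:[0,T]\times\mathbb C^N\to\mathbb C^N$. **Theorem.** Assume in addition: - (SPP) there is $C'$ with $\big\|kA_{h,0}\sum_{r=1}^{n-1}e^{rkA_{h,0}}\big\|\le C'$ whenever $k>0$ and $0\le nk\le T$; - (i) $u\in C^4([0,T],X)$, $f\in C^3([0,T]\times X,X)$, $u(t)\in D(A^3)$ and $f(t,u(t))\in D(A^2)$ for all $t\in[0,T]$, and $A^3u,\ A^2f(\cdot,u(\cdot))\in C^1([0,T],X)$; - (ii) either $C^*_h(t,U)=C_h\partial f(t,u(t))$ exactly for all $t\in[0,T]$,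 $U\in\mathbb C^N$ (as is possible for Dirichlet data), or (as for Robin/Neumann data) there are $r,C>0$ such that, for all $k>0$ and $nk\le T$ with $\|U_h^n-P_hu(t_n)\|\le r$, $$\big\|A_{h,0}^{-1}\big[C^*_{h,n}(U_h^n)-C_h\partial f(t_n,u(t_n))\big]\big\|\le C\|U_h^n-P_hu(t_n)\|;$$ - (iii) $u,\ Au,\ A^2u,\ f(\cdot,u(\cdot)),\ Af(\cdot,u(\cdot))\in C^1([0,T],Z)$. Then the global error $e_{h,n}=P_hu(t_n)-U_h^n$ satisfies $e_{h,n}=O(k^2+k\varepsilon_h+\eta_h)$: there are $C,k_0,h_0$ with $k_0,h_0>0$ such that, for all discretizations with $h\le h_0$, all $0<k\le k_0$ and all $n\ge0$ with $nk\le T$, $$\|e_{h,n}\|\le C\,(k^2+k\varepsilon_h+\eta_h).$$ -/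

import Mathlib

open Set Filter Topology MeasureTheory

/-! # Semigroups and their generators -/

section Semigroup

variable {X : Type*} [NormedAddCommGroup X] [NormedSpace ℂ X]

/-- `B` generates the semigroup `S` of type at most `ω`: `S` is a semigroup of bounded operators,
strongly continuous for `t > 0`, of growth bound at most `ω`, and the resolvent of `B` is the
Laplace transform of `S` on the half plane `Re z > ω`.  Every `C₀`-semigroup of type `ω` and its
infinitesimal generator satisfy this.  Density of the domain of `B` and strong continuity at `0`
are not required, so that the heat semigroup with Dirichlet condition on the space of all
continuous functions on a closed domain is included. -/
structure GeneratesSemigroup (B : X →ₗ.[ℂ] X) (S : ℝ → X →L[ℂ] X) (ω : ℝ) : Prop where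
  map_zero : S 0 = 1
  map_add : ∀ s t : ℝ, 0 ≤ s → 0 ≤ t → S (s + t) = S s * S t
  continuousOn : ∀ x : X, ContinuousOn (fun t => S t x) (Ioi 0)
  growth : ∀ ω₁ : ℝ, ω < ω₁ → ∃ M : ℝ, ∀ t : ℝ, 0 ≤ t → ‖S t‖ ≤ M * Real.exp (ω₁ * t)
  resolvent_right : ∀ z : ℂ, ω < z.re → ∀ x : X,
    ∃ hx : (∫ t in Ioi (0 : ℝ), Complex.exp (-(z * t)) • S t x) ∈ B.domain,
      z • (∫ t in Ioi (0 : ℝ), Complex.exp (-(z * t)) • S t x) - B ⟨_, hx⟩ = x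
  resolvent_left : ∀ z : ℂ, ω < z.re → ∀ x : B.domain,
    (∫ t in Ioi (0 : ℝ), Complex.exp (-(z * t)) • S t (z • (x : X) - B x)) = x

end Semigroup

/-- The operators `φ_j(t M) = t^{-j} ∫₀ᵗ e^{(t-τ) M} τ^{j-1} / (j-1)! dτ` for `j ≥ 1`, `t > 0`. -/
noncomputable def phiOp {E : Type*} [NormedAddCommGroup E] [NormedSpace ℂ E]
    (j : ℕ) (t : ℝ) (M : E →L[ℂ] E) : E →L[ℂ] E :=
  (t ^ j)⁻¹ • ∫ τ in (0 : ℝ)..t,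
    (τ ^ (j - 1) / ((j - 1).factorial : ℝ)) • NormedSpace.exp ((t - τ) • M)

/-! # The initial boundary value problem -/

/-- Data of `u' = A u + f(t, u)`, `u(0) = u₀`, `∂ u = g` in `X = C(K, ℂ)` with the maximum norm. -/
structure IBVP (K : Type*) [TopologicalSpace K] [CompactSpace K]
    (Y : Type*) [NormedAddCommGroup Y] [NormedSpace ℂ Y] where
  A : C(K, ℂ) →ₗ.[ℂ] C(K, ℂ)
  bd : A.domain →ₗ[ℂ] Y
  f : ℝ → C(K, ℂ) → C(K, ℂ)
  g : ℝ → Y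
  u₀ : C(K, ℂ)

namespace IBVP

variable {K : Type*} [TopologicalSpace K] [CompactSpace K]
  {Y : Type*} [NormedAddCommGroup Y] [NormedSpace ℂ Y]

/-- The kernel of the boundary operator, as a subspace of `X`. -/
noncomputable def kerBd (P : IBVP K Y) : Submodule ℂ C(K, ℂ) := (LinearMap.ker P.bd).map P.A.domain.subtype

/-- The restriction `A₀` of `A` to the kernel of the boundary operator. -/
noncomputable def A₀ (P : IBVP K Y) : C(K, ℂ) →ₗ.[ℂ] C(K, ℂ) := P.A.domRestrict P.kerBd

open Classical in
/-- `A x` for `x` in the domain of `A` (only used there). -/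
noncomputable def app (P : IBVP K Y) (x : C(K, ℂ)) : C(K, ℂ) :=
  if h : x ∈ P.A.domain then P.A ⟨x, h⟩ else 0

open Classical in
/-- `∂ x` for `x` in the domain of `A` (only used there). -/
noncomputable def bdry (P : IBVP K Y) (x : C(K, ℂ)) : Y :=
  if h : x ∈ P.A.domain then P.bd ⟨x, h⟩ else 0

/-- `u` is a solution on `[0, T]`. -/
structure IsSolution (P : IBVP K Y) (T : ℝ) (u : ℝ → C(K, ℂ)) : Prop where
  mem_domain : ∀ t ∈ Icc 0 T, u t ∈ P.A.domain
  equation : ∀ t ∈ Icc 0 T, HasDerivWithinAt u (P.app (u t) + P.f t (u t)) (Icc 0 T) t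
  initial : u 0 = P.u₀
  boundary : ∀ t ∈ Icc 0 T, P.bdry (u t) = P.g t

/-- The standing hypotheses on the problem and its solution `u`; `S t = e^{t A₀}`. -/
structure StandingHyp (P : IBVP K Y) (T : ℝ) (u : ℝ → C(K, ℂ))
    (S : ℝ → C(K, ℂ) →L[ℂ] C(K, ℂ)) (ω : ℝ) : Prop where
  bd_surjective : Function.Surjective P.bd
  /- the restriction `A₀` generates a semigroup of negative type -/
  generates : GeneratesSemigroup P.A₀ S ω
  type_neg : ω < 0
  /- the stationary problem -/
  stationary : ∀ z : ℂ, 0 < z.re → ∀ v : Y,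
    ∃! x : P.A.domain, P.A x = z • (x : C(K, ℂ)) ∧ P.bd x = v
  stationary_bound : ∃ ω₀ C : ℝ, ω < ω₀ ∧ ∀ z : ℂ, ω₀ ≤ z.re → ∀ x : P.A.domain,
    P.A x = z • (x : C(K, ℂ)) → ‖(x : C(K, ℂ))‖ ≤ C * ‖P.bd x‖
  /- smoothness of the source and of the boundary data -/
  f_contDiff : ContDiffOn ℝ 1 (fun q : ℝ × C(K, ℂ) => P.f q.1 q.2) (Icc 0 T ×ˢ univ)
  g_contDiff : ContDiffOn ℝ 1 P.g (Icc 0 T)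
  /- smoothness of the solution -/
  u_contDiff : ContDiffOn ℝ 2 u (Icc 0 T)
  Au_mem : ∀ t ∈ Icc 0 T, P.app (u t) ∈ P.A.domain
  Au_contDiff : ContDiffOn ℝ 1 (fun t => P.app (u t)) (Icc 0 T)
  AAu_contDiff : ContDiffOn ℝ 1 (fun t => P.app (P.app (u t))) (Icc 0 T)
  /- smoothness of the source along the solution -/
  fu_mem : ∀ t ∈ Icc 0 T, P.f t (u t) ∈ P.A.domain
  Afu_continuous : ContinuousOn (fun t => P.app (P.f t (u t))) (Icc 0 T)

/-- The extra regularity in `X` of the solution and of the source term. -/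
structure ExtraRegularity (P : IBVP K Y) (T : ℝ) (u : ℝ → C(K, ℂ)) : Prop where
  u_contDiff : ContDiffOn ℝ 4 u (Icc 0 T)
  f_contDiff : ContDiffOn ℝ 3 (fun q : ℝ × C(K, ℂ) => P.f q.1 q.2) (Icc 0 T ×ˢ univ)
  AAu_mem : ∀ t ∈ Icc 0 T, P.app (P.app (u t)) ∈ P.A.domain
  Afu_mem : ∀ t ∈ Icc 0 T, P.app (P.f t (u t)) ∈ P.A.domain
  AAAu_contDiff : ContDiffOn ℝ 1 (fun t => P.app (P.app (P.app (u t)))) (Icc 0 T)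
  AAfu_contDiff : ContDiffOn ℝ 1 (fun t => P.app (P.app (P.f t (u t)))) (Icc 0 T)

/-- `w ∈ C¹([0, T], Z)`, where the normed space `Z` is embedded in `X` by `j`. -/
def IsC1Into {Z : Type*} [NormedAddCommGroup Z] [NormedSpace ℂ Z] (T : ℝ)
    (j : Z →ₗ[ℂ] C(K, ℂ)) (w : ℝ → C(K, ℂ)) : Prop :=
  ∃ w' : ℝ → Z, ContDiffOn ℝ 1 w' (Icc 0 T) ∧ ∀ t ∈ Icc 0 T, j (w' t) = w t

/-- The extra regularity in `Z`. -/
structure ExtraRegularityZ {Z : Type*} [NormedAddCommGroup Z] [NormedSpace ℂ Z]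
    (P : IBVP K Y) (T : ℝ) (u : ℝ → C(K, ℂ)) (j : Z →ₗ[ℂ] C(K, ℂ)) : Prop where
  u_mem : IsC1Into T j u
  Au_mem : IsC1Into T j (fun t => P.app (u t))
  AAu_mem : IsC1Into T j (fun t => P.app (P.app (u t)))
  fu_mem : IsC1Into T j (fun t => P.f t (u t))
  Afu_mem : IsC1Into T j (fun t => P.app (P.f t (u t)))

end IBVP

/-! # Space discretization -/

/-- A space discretization: the nodes of the grid, the matrix `A_{h,0}`, the operator `C_h` that
carries the boundary information and the source term on `ℂᴺ` (with the maximum norm). -/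
structure SpaceDisc (K : Type*) (Y : Type*) [NormedAddCommGroup Y] [NormedSpace ℂ Y] where
  N : ℕ
  node : Fin N → K
  Ah : (Fin N → ℂ) →L[ℂ] (Fin N → ℂ)
  Ch : Y →ₗ[ℂ] (Fin N → ℂ)
  fh : ℝ → (Fin N → ℂ) → (Fin N → ℂ)

namespace SpaceDisc

variable {K : Type*} [TopologicalSpace K] [CompactSpace K]
  {Y : Type*} [NormedAddCommGroup Y] [NormedSpace ℂ Y]

/-- The discrete space `ℂᴺ` with the maximum norm. -/
abbrev E (D : SpaceDisc K Y) : Type := Fin D.N → ℂ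

/-- `P_h`: restriction of a function to the nodes. -/
noncomputable def proj (D : SpaceDisc K Y) (x : C(K, ℂ)) : D.E := fun i => x (D.node i)

/-- The elliptic projection: the solution of `A_{h,0} R_h x + C_h ∂x = P_h A x`. -/
noncomputable def ellProj (D : SpaceDisc K Y) (P : IBVP K Y) (x : C(K, ℂ)) : D.E :=
  Ring.inverse D.Ah (D.proj (P.app x) - D.Ch (P.bdry x))

/-- `v` solves `v'(s) = f(t + s, v(s))`, `v(0) = y` on `[0, τ]` in `ℂᴺ`. -/
def IsFlow (D : SpaceDisc K Y) (t τ : ℝ) (y : D.E) (v : ℝ → D.E) : Prop :=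
  v 0 = y ∧ ∀ s ∈ Icc 0 τ, HasDerivWithinAt v (D.fh (t + s) (v s)) (Icc 0 τ) s

/-- One step `U_h^n ↦ U_h^{n+1}` of length `k`, from time `t`, of the modified Strang splitting.
`Ψ τ t y` is the result of the integrator of the nonlinear part after a time `τ` from the value
`y` at time `t`; `Cs t U` is the vector used for `C_h ∂f(t, u(t))`. -/
noncomputable def strangStep (D : SpaceDisc K Y) (P : IBVP K Y) (T : ℝ)
    (Ψ : ℝ → ℝ → D.E → D.E) (Cs : ℝ → D.E → D.E) (k t : ℝ) (U : D.E) : D.E :=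
  let V : D.E := Ψ (k / 2) t U
  let W : D.E := NormedSpace.exp (k • D.Ah) V
    + k • phiOp 1 k D.Ah (D.Ch (P.g t) + (k / 2) • Cs t U)
    + k ^ 2 • phiOp 2 k D.Ah (D.Ch (derivWithin P.g (Icc 0 T) t) - Cs t U)
  Ψ (k / 2) (t + k / 2) W

/-- The numerical solution `U_h^n` at `t_n = n k`, with `U_h^0 = P_h u₀`. -/
noncomputable def strangSol (D : SpaceDisc K Y) (P : IBVP K Y) (T : ℝ)
    (Ψ : ℝ → ℝ → D.E → D.E) (Cs : ℝ → D.E → D.E) (k : ℝ) : ℕ → D.E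
  | 0 => D.proj P.u₀
  | n + 1 => D.strangStep P T Ψ Cs k (n * k) (strangSol D P T Ψ Cs k n)

variable {ι : Type*}

/-- Stability, with constants independent of the discretization in the family. -/
structure Stable (D : ι → SpaceDisc K Y) : Prop where
  contractive : ∀ i, ∀ t : ℝ, 0 ≤ t → ‖NormedSpace.exp (t • (D i).Ah)‖ ≤ 1
  isUnit : ∀ i, IsUnit (D i).Ah
  inverse_bound : ∃ C : ℝ, ∀ i, ‖Ring.inverse (D i).Ah‖ ≤ C

/-- Consistency on the subspace `Z ⊆ D(A)`, embedded by `j`. -/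
structure Consistent {Z : Type*} [NormedAddCommGroup Z] [NormedSpace ℂ Z]
    (D : ι → SpaceDisc K Y) (P : IBVP K Y) (S : ℝ → C(K, ℂ) →L[ℂ] C(K, ℂ))
    (j : Z →ₗ[ℂ] C(K, ℂ)) (ε η : ι → ℝ) : Prop where
  injective : Function.Injective j
  mem_domain : ∀ z, j z ∈ P.A.domain
  inv_mem : ∀ z, ∃ x : P.A₀.domain, P.A₀ x = j z ∧ (x : C(K, ℂ)) ∈ LinearMap.range j
  semigroup_mem : ∀ z, ∀ t : ℝ, 0 ≤ t → S t (j z) ∈ LinearMap.range j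
  consistent_eps : ∀ i z,
    ‖(D i).Ah ((D i).proj (j z) - (D i).ellProj P (j z))‖ ≤ ε i * ‖z‖
  consistent_eta : ∀ i z, ‖(D i).proj (j z) - (D i).ellProj P (j z)‖ ≤ η i * ‖z‖

/-- The source term on `ℂᴺ`: compatibility with `f`, smoothness, and a bound,
independent of the discretization, of the derivative in a neighbourhood of the solution. -/
structure SourceHyp (D : ι → SpaceDisc K Y) (P : IBVP K Y) (T : ℝ) (u : ℝ → C(K, ℂ)) : Prop where
  compatible : ∀ i, ∀ t ∈ Icc 0 T, ∀ x : C(K, ℂ),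
    (D i).proj (P.f t x) = (D i).fh t ((D i).proj x)
  contDiff : ∀ i, ContDiffOn ℝ 2 (fun q : ℝ × (D i).E => (D i).fh q.1 q.2) (Icc 0 T ×ˢ univ)
  deriv_bound : ∃ r L : ℝ, 0 < r ∧ ∀ i, ∀ t ∈ Icc 0 T, ∀ U : (D i).E,
    ‖U - (D i).proj (u t)‖ ≤ r → ‖fderiv ℝ ((D i).fh t) U‖ ≤ L

/-- `Ψ` integrates `v' = f(t + s, v)` in `ℂᴺ` with order `p`, uniformly in the discretization and
for initial values in a neighbourhood of the solution. -/
def HasOrder (D : ι → SpaceDisc K Y) (T : ℝ) (u : ℝ → C(K, ℂ))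
    (Ψ : ∀ i, ℝ → ℝ → (D i).E → (D i).E) (p : ℕ) : Prop :=
  ∃ r τ₀ C : ℝ, 0 < r ∧ 0 < τ₀ ∧ ∀ i, ∀ t τ : ℝ, 0 ≤ t → 0 < τ → τ ≤ τ₀ → t + τ ≤ T →
    ∀ y : (D i).E, ‖y - (D i).proj (u t)‖ ≤ r → ∀ v : ℝ → (D i).E, (D i).IsFlow t τ y v →
      ‖Ψ i τ t y - v τ‖ ≤ C * τ ^ (p + 1)

/-- The bound by summation by parts. -/
def SummationByParts (D : ι → SpaceDisc K Y) (T : ℝ) : Prop :=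
  ∃ C : ℝ, ∀ i, ∀ k : ℝ, 0 < k → ∀ n : ℕ, n * k ≤ T →
    ‖k • ((D i).Ah * ∑ r ∈ Finset.Icc 1 (n - 1), NormedSpace.exp ((r * k) • (D i).Ah))‖ ≤ C

/-- `C_h ∂f(t_n, u(t_n))` is known exactly. -/
def BoundaryExact (D : ι → SpaceDisc K Y) (P : IBVP K Y) (T : ℝ) (u : ℝ → C(K, ℂ))
    (Cs : ∀ i, ℝ → (D i).E → (D i).E) : Prop :=
  ∀ i, ∀ t ∈ Icc 0 T, ∀ U, Cs i t U = (D i).Ch (P.bdry (P.f t (u t)))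

/-- `C_h ∂f(t_n, u(t_n))` is approximated from the numerical solution `U_h^n`, as long as this is
in a neighbourhood of the exact solution, with an error controlled by that of `U_h^n`. -/
def BoundaryApprox (D : ι → SpaceDisc K Y) (P : IBVP K Y) (T : ℝ) (u : ℝ → C(K, ℂ))
    (Ψ : ∀ i, ℝ → ℝ → (D i).E → (D i).E) (Cs : ∀ i, ℝ → (D i).E → (D i).E) : Prop :=
  ∃ r C : ℝ, 0 < r ∧ ∀ i, ∀ k : ℝ, 0 < k → ∀ n : ℕ, n * k ≤ T →
    ‖(D i).strangSol P T (Ψ i) (Cs i) k n - (D i).proj (u (n * k))‖ ≤ r →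
    ‖Ring.inverse (D i).Ah (Cs i (n * k) ((D i).strangSol P T (Ψ i) (Cs i) k n)
        - (D i).Ch (P.bdry (P.f (n * k) (u (n * k)))))‖
      ≤ C * ‖(D i).strangSol P T (Ψ i) (Cs i) k n - (D i).proj (u (n * k))‖

end SpaceDisc

/-! Write x_n for the numerical solution minus the nodal values of u, and B for the matrix `Ah`. One
step satisfies x_{n+1} = e^{kB} x_n + y_n + defect, where y_n is `leadingError` and the defect is
O(k³ + k²ε + kη + k‖x_n‖) (`norm_local_error_le`). A defect of this size sums to the claimed rate by
Gronwall. The leading part is only O(k² + η) per step, and adding norms would lose a factor k.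

The leading part is recovered by cancellation. It is a sum of three terms Q ψ(t_n) in which Q is 1 -
e^{kB}, k - kφ₁ or k²/2 - k²φ₂, and ψ is Lipschitz in time. Abel summation (`norm_sum_pow_mul_le`)
reduces matters to bounds on the partial sums of e^{rkB} Q. For 1 - e^{kB} they telescope. The other
two operators equal -B k²φ₂ and -B k³φ₃ by the recurrence `phiOp_succ_mul`, so the hypothesis on kB
Σ e^{rkB} applies (`norm_sum_exp_mul_le`).

The form of the local error comes from two computations. For the linear step, `Ch_bdry_eq` rewrites
the boundary data as P_h A - B P_h plus a consistency error. After this each B meets a φ-operator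
and is absorbed (`strang_linear_step_eq`), which is why errors of the boundary correction need to be
small only after applying B⁻¹. The half steps are compared with explicit quadratic polynomials in
time whose defect in the nonlinear equation is O(k²) (`exists_halfStep_bound`). These expansions
need g' = ∂Au + ∂f and (Au)' = A²u + Af, which hold because A and ∂ are jointly closed
(`StandingHyp.closed`).

All estimates of f hold only near the solution. Strong induction on n closes the argument: the final
bound for earlier indices keeps the iterates in the required neighbourhood once k and h are small.
-/

/-! # Summation by parts and a discrete Gronwall inequality -/

section Discrete

/-- Summation by parts for a discrete convolution with the powers of `e`. -/
theorem sum_pow_mul_eq_abel {F : Type*} [NormedAddCommGroup F] [NormedSpace ℂ F]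
    (e Q : F →L[ℂ] F) (n : ℕ) (ψ : ℕ → F) :
    ∑ m ∈ Finset.range n, (e ^ (n - 1 - m) * Q) (ψ m)
      = (∑ r ∈ Finset.range n, e ^ r * Q) (ψ 0)
        + ∑ m ∈ Finset.range n, (∑ r ∈ Finset.range (n - 1 - m), e ^ r * Q) (ψ (m + 1) - ψ m) := by
  induction n generalizing ψ with
  | zero => simp
  | succ n ih =>
    have e1 : ∀ m, n - 1 - m = n - (m + 1) := fun m => by omega
    -- The induction peels off the first term of the sequence, since the exponents are counted from
    -- the end; hence the shifted sequence.
    have h1 := ih (fun m => ψ (m + 1))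
    simp only [e1] at h1
    rw [Finset.sum_range_succ', Finset.sum_range_succ (fun r => e ^ r * Q) n,
      Finset.sum_range_succ' (fun m => (∑ r ∈ Finset.range (n + 1 - 1 - m), e ^ r * Q)
        (ψ (m + 1) - ψ m))]
    simp only [add_tsub_cancel_right, tsub_zero]
    rw [h1, zero_add, map_sub, add_apply]
    generalize (∑ r ∈ Finset.range n, e ^ r * Q) = H
    generalize ∑ m ∈ Finset.range n,
      (∑ r ∈ Finset.range (n - (m + 1)), e ^ r * Q) (ψ (m + 1 + 1) - ψ (m + 1)) = s
    abel

/-- The size of the sum is governed by the initial value and the total variation of `ψ`, not by `n`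
times its size. For `ψ` sampled from a Lipschitz function with step k, `n * d` stays bounded. -/
theorem norm_sum_pow_mul_le {F : Type*} [NormedAddCommGroup F] [NormedSpace ℂ F]
    (e Q : F →L[ℂ] F) (n : ℕ) (ψ : ℕ → F) {G c d : ℝ} (hG : 0 ≤ G)
    (hQ : ∀ m ≤ n, ‖∑ r ∈ Finset.range m, e ^ r * Q‖ ≤ G) (h0 : ‖ψ 0‖ ≤ c)
    (hψ : ∀ m < n, ‖ψ (m + 1) - ψ m‖ ≤ d) :
    ‖∑ m ∈ Finset.range n, (e ^ (n - 1 - m) * Q) (ψ m)‖ ≤ G * (c + n * d) := by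
  rw [sum_pow_mul_eq_abel]
  have h1 : ‖(∑ r ∈ Finset.range n, e ^ r * Q) (ψ 0)‖ ≤ G * c :=
    (ContinuousLinearMap.le_opNorm _ _).trans
      (mul_le_mul (hQ n le_rfl) h0 (norm_nonneg _) hG)
  have h2 : ‖∑ m ∈ Finset.range n,
      (∑ r ∈ Finset.range (n - 1 - m), e ^ r * Q) (ψ (m + 1) - ψ m)‖ ≤ n * (G * d) := by
    refine (norm_sum_le_of_le _ (f := fun m => (∑ r ∈ Finset.range (n - 1 - m), e ^ r * Q)
      (ψ (m + 1) - ψ m)) (n := fun _ => G * d) fun m hm => ?_).trans (by simp)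
    exact (ContinuousLinearMap.le_opNorm _ _).trans
      (mul_le_mul (hQ _ (by omega)) (hψ m (Finset.mem_range.1 hm)) (norm_nonneg _) hG)
  refine (norm_add_le _ _).trans ?_
  linarith

/-- Solution formula for a linear recursion started at zero. -/
theorem recursion_eq_sum {F : Type*} [NormedAddCommGroup F] [NormedSpace ℂ F]
    (e : F →L[ℂ] F) (x y : ℕ → F) (h0 : x 0 = 0) (n : ℕ)
    (h : ∀ m < n, x (m + 1) = e (x m) + y m) :
    x n = ∑ m ∈ Finset.range n, (e ^ (n - 1 - m)) (y m) := by
  induction n with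
  | zero => simpa using h0
  | succ n ih =>
    rw [h n (Nat.lt_succ_self n), ih fun m hm => h m (hm.trans (Nat.lt_succ_self n)),
      Finset.sum_range_succ, map_sum]
    simp only [add_tsub_cancel_right, tsub_self, pow_zero, one_apply_eq_self]
    congr 1
    refine Finset.sum_congr rfl fun m hm => ?_
    have : n - m = (n - 1 - m) + 1 := by have := Finset.mem_range.1 hm; omega
    rw [this, pow_succ']
    rfl

/-- Discrete Gronwall inequality. -/
theorem le_mul_one_add_pow_of_le_sum {a : ℕ → ℝ} {M c : ℝ} (hc : 0 ≤ c) (n : ℕ)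
    (h : ∀ m ≤ n, a m ≤ M + c * ∑ l ∈ Finset.range m, a l) :
    ∀ m ≤ n, a m ≤ M * (1 + c) ^ m := by
  -- The induction runs on the right-hand side of the hypothesis, which satisfies a one-step
  -- recursion, unlike `a` itself.
  have key : ∀ m ≤ n, M + c * ∑ l ∈ Finset.range m, a l ≤ M * (1 + c) ^ m := by
    intro m
    induction m with
    | zero => simp
    | succ m ih =>
      intro hm
      have h1 := ih (by omega)
      have h2 := h m (by omega)
      rw [Finset.sum_range_succ, pow_succ]
      nlinarith [mul_le_mul_of_nonneg_left (h2.trans h1) hc]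
  exact fun m hm => (h m hm).trans (key m hm)

end Discrete

/-! # The exponential integrals `tʲ φ_j(t M)` -/

section PhiOp

variable {E : Type*} [NormedAddCommGroup E] [NormedSpace ℂ E]

theorem pow_smul_phiOp (j : ℕ) {t : ℝ} (ht : 0 < t) (M : E →L[ℂ] E) :
    t ^ j • phiOp j t M = ∫ τ in (0 : ℝ)..t,
      (τ ^ (j - 1) / ((j - 1).factorial : ℝ)) • NormedSpace.exp ((t - τ) • M) := by
  rw [phiOp, smul_smul, mul_inv_cancel₀ (by positivity), one_smul]

theorem norm_pow_smul_phiOp_le {j : ℕ} (hj : 1 ≤ j) {t : ℝ} (ht : 0 < t) {M : E →L[ℂ] E}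
    (hM : ∀ s : ℝ, 0 ≤ s → ‖NormedSpace.exp (s • M)‖ ≤ 1) : ‖t ^ j • phiOp j t M‖ ≤ t ^ j := by
  rw [pow_smul_phiOp j ht]
  have h := intervalIntegral.norm_integral_le_of_norm_le_const (a := 0) (b := t)
    (f := fun τ => (τ ^ (j - 1) / ((j - 1).factorial : ℝ)) • NormedSpace.exp ((t - τ) • M))
    (C := t ^ (j - 1)) (by
      intro τ hτ
      rw [uIoc_of_le ht.le] at hτ
      rw [norm_smul, Real.norm_of_nonneg (by have := hτ.1; positivity)]
      have h1 : τ ^ (j - 1) / ((j - 1).factorial : ℝ) ≤ t ^ (j - 1) := by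
        refine (div_le_self (by have := hτ.1; positivity) ?_).trans
          (pow_le_pow_left₀ hτ.1.le hτ.2 _)
        exact_mod_cast Nat.one_le_iff_ne_zero.2 (Nat.factorial_ne_zero _)
      calc _ ≤ t ^ (j - 1) * 1 := mul_le_mul h1 (hM _ (by linarith [hτ.2])) (norm_nonneg _)
            (by positivity)
        _ = _ := mul_one _)
  rw [sub_zero, abs_of_pos ht, ← pow_succ, Nat.sub_add_cancel hj] at h
  exact h

variable [CompleteSpace E]

theorem hasDerivAt_exp_sub_smul (M : E →L[ℂ] E) (t τ : ℝ) :
    HasDerivAt (fun s : ℝ => NormedSpace.exp ((t - s) • M))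
      (-(NormedSpace.exp ((t - τ) • M) * M)) τ := by
  have h1 := hasDerivAt_exp_smul_const (𝕂 := ℝ) M (t - τ)
  have h2 : HasDerivAt (fun s : ℝ => t - s) (-1) τ := by
    simpa using (hasDerivAt_id τ).const_sub t
  have h3 := h1.scomp τ h2
  rw [neg_one_smul] at h3
  exact h3

theorem continuous_exp_sub_smul (M : E →L[ℂ] E) (t : ℝ) :
    Continuous fun s : ℝ => NormedSpace.exp ((t - s) • M) :=
  continuous_iff_continuousAt.2 fun τ => (hasDerivAt_exp_sub_smul M t τ).continuousAt

theorem intervalIntegrable_phiOp (j : ℕ) (t : ℝ) (M : E →L[ℂ] E) :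
    IntervalIntegrable (fun τ : ℝ =>
      (τ ^ (j - 1) / ((j - 1).factorial : ℝ)) • NormedSpace.exp ((t - τ) • M)) volume 0 t :=
  (((continuous_id.pow _).div_const _).smul (continuous_exp_sub_smul M t)).intervalIntegrable _ _

theorem pow_smul_phiOp_mul (j : ℕ) {t : ℝ} (ht : 0 < t) (M : E →L[ℂ] E) :
    (t ^ j • phiOp j t M) * M = ∫ τ in (0 : ℝ)..t,
      (τ ^ (j - 1) / ((j - 1).factorial : ℝ)) • (NormedSpace.exp ((t - τ) • M) * M) := by
  rw [pow_smul_phiOp j ht]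
  have h := ((ContinuousLinearMap.mul ℝ (E →L[ℂ] E)).flip M).intervalIntegral_comp_comm
    (intervalIntegrable_phiOp j t M)
  simp only [ContinuousLinearMap.flip_apply, ContinuousLinearMap.mul_apply', smul_mul_assoc] at h
  exact h.symm

theorem commute_pow_smul_phiOp (j : ℕ) {t : ℝ} (ht : 0 < t) (M : E →L[ℂ] E) :
    M * (t ^ j • phiOp j t M) = (t ^ j • phiOp j t M) * M := by
  rw [pow_smul_phiOp_mul j ht, pow_smul_phiOp j ht]
  have h := (ContinuousLinearMap.mul ℝ (E →L[ℂ] E) M).intervalIntegral_comp_comm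
    (intervalIntegrable_phiOp j t M)
  simp only [ContinuousLinearMap.mul_apply'] at h
  rw [← h]
  refine intervalIntegral.integral_congr fun τ _ => ?_
  have : Commute M (NormedSpace.exp ((t - τ) • M)) :=
    ((Commute.refl M).smul_right (t - τ)).exp_right
  simp only [mul_smul_comm]
  rw [this.eq]

theorem phiOp_one_mul {t : ℝ} (ht : 0 < t) (M : E →L[ℂ] E) :
    (t ^ 1 • phiOp 1 t M) * M = NormedSpace.exp (t • M) - 1 := by
  rw [pow_smul_phiOp_mul 1 ht]
  have h := intervalIntegral.integral_eq_sub_of_hasDerivAt (a := 0) (b := t)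
    (fun τ _ => (hasDerivAt_exp_sub_smul M t τ).neg)
    (by
      simp only [neg_neg]
      exact ((continuous_exp_sub_smul M t).mul continuous_const).intervalIntegrable _ _)
  simp only [neg_neg] at h
  simp only [tsub_self, pow_zero, Nat.factorial_zero, Nat.cast_one, div_one, one_smul, h]
  simp [NormedSpace.exp_zero]
  abel

/-- Integration by parts: M times the exponential is minus its derivative in τ. The boundary term at
τ = t is the multiple of the identity; the one at 0 vanishes because `1 ≤ j`. -/
theorem phiOp_succ_mul {j : ℕ} (hj : 1 ≤ j) {t : ℝ} (ht : 0 < t) (M : E →L[ℂ] E) :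
    (t ^ (j + 1) • phiOp (j + 1) t M) * M
      = t ^ j • phiOp j t M - (t ^ j / (j.factorial : ℝ)) • (1 : E →L[ℂ] E) := by
  obtain ⟨j, rfl⟩ := Nat.exists_eq_add_of_le' hj
  rw [pow_smul_phiOp_mul _ ht, pow_smul_phiOp _ ht]
  simp only [add_tsub_cancel_right]
  have hd : ∀ τ : ℝ, HasDerivAt
      (fun s : ℝ => (s ^ (j + 1) / ((j + 1).factorial : ℝ)) • NormedSpace.exp ((t - s) • M))
      ((τ ^ (j + 1) / ((j + 1).factorial : ℝ)) • (-(NormedSpace.exp ((t - τ) • M) * M))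
        + (τ ^ j / (j.factorial : ℝ)) • NormedSpace.exp ((t - τ) • M)) τ := by
    intro τ
    have h1 : HasDerivAt (fun s : ℝ => s ^ (j + 1) / ((j + 1).factorial : ℝ))
        (τ ^ j / (j.factorial : ℝ)) τ := by
      have := (hasDerivAt_pow (j + 1) τ).div_const ((j + 1).factorial : ℝ)
      have e1 : ((j + 1 : ℕ) : ℝ) * τ ^ (j + 1 - 1) / ((j + 1).factorial : ℝ)
          = τ ^ j / (j.factorial : ℝ) := by
        have : (j.factorial : ℝ) ≠ 0 := by exact_mod_cast Nat.factorial_ne_zero j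
        have : (j : ℝ) + 1 ≠ 0 := by positivity
        rw [Nat.factorial_succ, add_tsub_cancel_right]
        push_cast
        field_simp
      rwa [e1] at this
    exact h1.smul (hasDerivAt_exp_sub_smul M t τ)
  have hc1 : Continuous fun τ : ℝ =>
      (τ ^ (j + 1) / ((j + 1).factorial : ℝ)) • (-(NormedSpace.exp ((t - τ) • M) * M)) :=
    ((continuous_id.pow _).div_const _).smul
      ((continuous_exp_sub_smul M t).mul continuous_const).neg
  have hc2 : Continuous fun τ : ℝ =>
      (τ ^ j / (j.factorial : ℝ)) • NormedSpace.exp ((t - τ) • M) :=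
    ((continuous_id.pow _).div_const _).smul (continuous_exp_sub_smul M t)
  have h := intervalIntegral.integral_eq_sub_of_hasDerivAt (a := 0) (b := t)
    (fun τ _ => hd τ) ((hc1.add hc2).intervalIntegrable _ _)
  rw [intervalIntegral.integral_add (hc1.intervalIntegrable _ _)
    (hc2.intervalIntegrable _ _)] at h
  simp only [smul_neg, intervalIntegral.integral_neg] at h
  simp only [sub_self, zero_smul, NormedSpace.exp_zero, ne_eq, Nat.add_eq_zero_iff, one_ne_zero,
    and_false, not_false_eq_true, zero_pow, zero_div, sub_zero] at h
  rw [← h]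
  abel

theorem exp_nat_mul_smul (M : E →L[ℂ] E) (r : ℕ) (k : ℝ) :
    NormedSpace.exp (((r : ℝ) * k) • M) = NormedSpace.exp (k • M) ^ r := by
  let +nondep : NormedAlgebra ℚ (E →L[ℂ] E) := .restrictScalars ℚ ℂ (E →L[ℂ] E)
  rw [mul_smul, Nat.cast_smul_eq_nsmul, NormedSpace.exp_nsmul]

/-- A factor `k • M` in `Q` is exactly what the summation-by-parts hypothesis controls; `Q'` is what
remains and carries the powers of k. That hypothesis starts its sum at r = 1, so the term r = 0,
which is `Q` itself, is estimated separately by `C₁`. -/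
theorem norm_sum_exp_mul_le {M Q Q' : E →L[ℂ] E} {k T G C₁ C₂ : ℝ}
    (hG : ∀ n : ℕ, n * k ≤ T →
      ‖k • (M * ∑ r ∈ Finset.Icc 1 (n - 1), NormedSpace.exp ((r * k) • M))‖ ≤ G)
    (hT : 0 ≤ T) (hQ : Q = -(k • (M * Q'))) (h1 : ‖Q‖ ≤ C₁) (h2 : ‖Q'‖ ≤ C₂)
    (m : ℕ) (hm : m * k ≤ T) :
    ‖∑ r ∈ Finset.range m, NormedSpace.exp (k • M) ^ r * Q‖ ≤ C₁ + G * C₂ := by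
  have hG0 : 0 ≤ G := (norm_nonneg _).trans (hG 0 (by simpa using hT))
  have hC2 : 0 ≤ C₂ := (norm_nonneg _).trans h2
  have hC1 : 0 ≤ C₁ := (norm_nonneg _).trans h1
  rcases m with _ | m
  · simp; positivity
  have hc : Commute (∑ r ∈ Finset.Icc 1 m, NormedSpace.exp (k • M) ^ r) M :=
    Commute.sum_left _ _ _ fun r _ =>
      (((Commute.refl M).smul_right k).exp_right.symm).pow_left r
  have h3 := hG (m + 1) hm
  simp only [add_tsub_cancel_right, exp_nat_mul_smul] at h3
  rw [Finset.range_eq_Ico, Finset.sum_eq_sum_Ico_succ_bot (Nat.succ_pos m), pow_zero, one_mul]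
  refine (norm_add_le _ _).trans (add_le_add h1 ?_)
  have h4 : ∑ r ∈ Finset.Ico (0 + 1) (m + 1), NormedSpace.exp (k • M) ^ r * Q
      = -((k • (M * ∑ r ∈ Finset.Icc 1 m, NormedSpace.exp (k • M) ^ r)) * Q') := by
    rw [zero_add, ← Finset.sum_mul, hQ]
    have : Finset.Ico 1 (m + 1) = Finset.Icc 1 m := by ext; simp
    rw [this, mul_neg, mul_smul_comm, ← mul_assoc, hc.eq, smul_mul_assoc]
  rw [h4, norm_neg]
  exact (norm_mul_le _ _).trans (mul_le_mul h3 h2 (norm_nonneg _) hG0)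

/-- The geometric sum telescopes to 1 - e^{mkM}. The bound on the norm of 1 is read off from the
exponential at time 0, because `E` may be trivial. -/
theorem norm_sum_exp_mul_one_sub_le {M : E →L[ℂ] E} {k : ℝ} (hk : 0 < k)
    (hM : ∀ s : ℝ, 0 ≤ s → ‖NormedSpace.exp (s • M)‖ ≤ 1) (m : ℕ) :
    ‖∑ r ∈ Finset.range m, NormedSpace.exp (k • M) ^ r * (1 - NormedSpace.exp (k • M))‖ ≤ 2 := by
  rw [← Finset.sum_mul, geom_sum_mul_neg, ← exp_nat_mul_smul]
  have h1 := hM (m * k) (by positivity)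
  have h0 := hM 0 le_rfl
  rw [zero_smul, NormedSpace.exp_zero] at h0
  exact (norm_sub_le _ _).trans (by linarith)

end PhiOp

/-! # Solutions of ordinary differential equations near a given curve -/

section Flow

variable {F : Type*} [NormedAddCommGroup F] [NormedSpace ℝ F]

/-- The solution from the Picard-Lindelöf theorem stays in the ball. -/
theorem IsPicardLindelof.exists_solution_mem_closedBall [CompleteSpace F] {f : ℝ → F → F}
    {tmin tmax : ℝ} {t₀ : Icc tmin tmax} {x₀ : F} {a L K : NNReal}
    (hf : IsPicardLindelof f t₀ x₀ a 0 L K) :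
    ∃ v : ℝ → F, v t₀ = x₀ ∧ ∀ t ∈ Icc tmin tmax,
      HasDerivWithinAt v (f t (v t)) (Icc tmin tmax) t ∧ v t ∈ Metric.closedBall x₀ a := by
  obtain ⟨α, hα⟩ := ODE.FunSpace.exists_isFixedPt_next hf (Metric.mem_closedBall_self le_rfl)
  refine ⟨α.compProj, by rw [ODE.FunSpace.compProj_val, ← hα, ODE.FunSpace.next_apply₀],
    fun t ht => ⟨?_, α.compProj_mem_closedBall hf.mul_max_le⟩⟩
  apply ODE.hasDerivWithinAt_picard_Icc t₀.2 hf.continuousOn_uncurry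
    α.continuous_compProj.continuousOn (fun _ _ => α.compProj_mem_closedBall hf.mul_max_le)
    x₀ ht |>.congr_of_mem _ ht
  intro t' ht'
  nth_rw 1 [← hα]
  rw [ODE.FunSpace.compProj_of_mem ht', ODE.FunSpace.next_apply]

/-- Local existence, with quantitative time of existence, near a Lipschitz curve `c`. -/
theorem exists_solution_near_curve [CompleteSpace F] {G : ℝ → F → F} {c : ℝ → F} {y : F}
    {τ r L M Λ : ℝ} (hτ : 0 < τ) (hr : 0 < r) (hL : 0 ≤ L) (hM : 0 ≤ M)
    (hlip : ∀ s ∈ Icc 0 τ, ∀ x x' : F, ‖x - c s‖ ≤ r → ‖x' - c s‖ ≤ r →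
      ‖G s x - G s x'‖ ≤ L * ‖x - x'‖)
    (hcont : ∀ x, ContinuousOn (fun s => G s x) (Icc 0 τ))
    (hc : ∀ s ∈ Icc 0 τ, ‖c s - c 0‖ ≤ Λ * s) (hG : ∀ s ∈ Icc 0 τ, ‖G s (c s)‖ ≤ M)
    (hy : ‖y - c 0‖ ≤ r / 4) (h1 : τ * |Λ| ≤ r / 4) (h2 : τ * (M + L * r) ≤ r / 4) :
    ∃ v : ℝ → F, v 0 = y ∧ ∀ s ∈ Icc 0 τ,
      HasDerivWithinAt v (G s (v s)) (Icc 0 τ) s ∧ ‖v s - c s‖ ≤ r := by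
  -- Three distances of at most r/4 add up: from x to y, from y to the curve at 0, and the drift of
  -- the curve.
  have hball : ∀ s ∈ Icc 0 τ, ∀ x ∈ Metric.closedBall y (r / 4), ‖x - c s‖ ≤ r := by
    intro s hs x hx
    rw [mem_closedBall_iff_norm] at hx
    have h3 : ‖c s - c 0‖ ≤ r / 4 := by
      refine (hc s hs).trans (le_trans ?_ h1)
      calc Λ * s ≤ |Λ| * s := mul_le_mul_of_nonneg_right (le_abs_self _) hs.1
        _ ≤ |Λ| * τ := mul_le_mul_of_nonneg_left hs.2 (abs_nonneg _)
        _ = τ * |Λ| := mul_comm _ _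
    have h4 : x - c s = (x - y) + (y - c 0) - (c s - c 0) := by abel
    rw [h4]
    refine (norm_sub_le _ _).trans ?_
    have := norm_add_le (x - y) (y - c 0)
    linarith
  have hB : 0 ≤ M + L * r := by positivity
  have hpl : IsPicardLindelof G (tmin := 0) (tmax := τ) ⟨0, le_rfl, hτ.le⟩ y
      ⟨r / 4, by positivity⟩ 0 ⟨M + L * r, hB⟩ ⟨L, hL⟩ := by
    refine ⟨fun s hs => ?_, fun x _ => hcont x, fun s hs x hx => ?_, ?_⟩
    · refine LipschitzOnWith.of_dist_le_mul fun x hx x' hx' => ?_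
      rw [dist_eq_norm, dist_eq_norm]
      exact hlip s hs x x' (hball s hs x hx) (hball s hs x' hx')
    · have h5 := hlip s hs x (c s) (hball s hs x hx) (by simpa using hr.le)
      have h6 : ‖G s x‖ ≤ ‖G s x - G s (c s)‖ + ‖G s (c s)‖ := by
        simpa using norm_add_le (G s x - G s (c s)) (G s (c s))
      have h7 := mul_le_mul_of_nonneg_left (hball s hs x hx) hL
      have h8 := hG s hs
      show ‖G s x‖ ≤ M + L * r
      linarith
    · show (M + L * r) * max (τ - 0) (0 - 0) ≤ r / 4 - 0
      rw [sub_zero, sub_zero, max_eq_left hτ.le]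
      linarith
  obtain ⟨v, hv0, hv⟩ := hpl.exists_solution_mem_closedBall
  exact ⟨v, hv0, fun s hs => ⟨(hv s hs).1, hball s hs _ (hv s hs).2⟩⟩

/-- Comparison of a solution with an approximate solution, for short times. -/
theorem norm_solution_sub_approx_le {G : ℝ → F → F} {c v z z' : ℝ → F}
    {τ r L δ : ℝ} (hτ : 0 < τ) (hL : 0 ≤ L) (hτL : τ * L ≤ 1 / 2)
    (hlip : ∀ s ∈ Icc 0 τ, ∀ x x' : F, ‖x - c s‖ ≤ r → ‖x' - c s‖ ≤ r →
      ‖G s x - G s x'‖ ≤ L * ‖x - x'‖)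
    (hv : ∀ s ∈ Icc 0 τ, HasDerivWithinAt v (G s (v s)) (Icc 0 τ) s ∧ ‖v s - c s‖ ≤ r)
    (hz : ∀ s ∈ Icc 0 τ, HasDerivWithinAt z (z' s) (Icc 0 τ) s ∧ ‖z s - c s‖ ≤ r)
    (hd : ∀ s ∈ Icc 0 τ, ‖G s (z s) - z' s‖ ≤ δ) :
    ‖v τ - z τ - (v 0 - z 0)‖ ≤ τ * (2 * L * ‖v 0 - z 0‖ + 2 * δ) := by
  have h0 : (0 : ℝ) ∈ Icc 0 τ := ⟨le_rfl, hτ.le⟩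
  have h1 : τ ∈ Icc (0 : ℝ) τ := ⟨hτ.le, le_rfl⟩
  have hder : ∀ s ∈ Icc 0 τ, HasDerivWithinAt (fun s => v s - z s) (G s (v s) - z' s)
      (Icc 0 τ) s := fun s hs => (hv s hs).1.sub (hz s hs).1
  -- The maximum m of the difference takes the place of Gronwall: since τL ≤ 1/2, the term τLm can
  -- be absorbed. The estimate concerns the change of the difference, so the initial error is
  -- transported with factor one up to O(τ).
  obtain ⟨σ, hσ, hmax⟩ := isCompact_Icc.exists_isMaxOn ⟨0, h0⟩
    (ContinuousOn.norm fun s hs => (hder s hs).continuousWithinAt)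
  set m := ‖v σ - z σ‖ with hm
  have hb : ∀ s ∈ Icc 0 τ, ‖G s (v s) - z' s‖ ≤ L * m + δ := by
    intro s hs
    have e1 : G s (v s) - z' s = (G s (v s) - G s (z s)) + (G s (z s) - z' s) := by abel
    rw [e1]
    have h2 := hlip s hs _ _ (hv s hs).2 (hz s hs).2
    have h3 : ‖v s - z s‖ ≤ m := hmax hs
    have h4 := mul_le_mul_of_nonneg_left h3 hL
    have := hd s hs
    exact (norm_add_le _ _).trans (by linarith)
  have hmv : ∀ s ∈ Icc 0 τ, ‖v s - z s - (v 0 - z 0)‖ ≤ (L * m + δ) * τ := by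
    intro s hs
    have h2 := (convex_Icc (0 : ℝ) τ).norm_image_sub_le_of_norm_hasDerivWithin_le hder hb h0 hs
    refine h2.trans (mul_le_mul_of_nonneg_left ?_ ((norm_nonneg _).trans (hb 0 h0)))
    rw [sub_zero, Real.norm_of_nonneg hs.1]
    exact hs.2
  have h3 := hmv σ hσ
  have h4 : m ≤ ‖v σ - z σ - (v 0 - z 0)‖ + ‖v 0 - z 0‖ := by
    simpa using norm_add_le (v σ - z σ - (v 0 - z 0)) (v 0 - z 0)
  have hm0 : 0 ≤ m := norm_nonneg _
  have hδ : 0 ≤ δ := (norm_nonneg _).trans (hd 0 h0)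
  have h5 : m ≤ 2 * ‖v 0 - z 0‖ + 2 * (τ * δ) := by nlinarith
  refine (hmv τ h1).trans ?_
  have h6 : L * m ≤ L * (2 * ‖v 0 - z 0‖ + 2 * (τ * δ)) := mul_le_mul_of_nonneg_left h5 hL
  have h7 : τ * L * δ ≤ 1 / 2 * δ := mul_le_mul_of_nonneg_right hτL hδ
  nlinarith

end Flow

/-! # Half steps with the integrator of the nonlinear part -/

namespace SpaceDisc

variable {K : Type*} [TopologicalSpace K] [CompactSpace K]
  {Y : Type*} [NormedAddCommGroup Y] [NormedSpace ℂ Y] {ι : Type*}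

/-- The restriction to the nodes as a continuous linear map. -/
noncomputable def projL (D : SpaceDisc K Y) : C(K, ℂ) →L[ℝ] D.E :=
  LinearMap.mkContinuous
    { toFun := D.proj
      map_add' := fun _ _ => rfl
      map_smul' := fun _ _ => rfl } 1 fun x => by
    rw [one_mul]
    exact (pi_norm_le_iff_of_nonneg (norm_nonneg x)).2 fun i => x.norm_coe_le_norm _

theorem projL_apply (D : SpaceDisc K Y) (x : C(K, ℂ)) : D.projL x = D.proj x := rfl

theorem norm_projL_le (D : SpaceDisc K Y) (x : C(K, ℂ)) : ‖D.projL x‖ ≤ ‖x‖ :=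
  (pi_norm_le_iff_of_nonneg (norm_nonneg x)).2 fun _ => x.norm_coe_le_norm _

/-- The ball is convex, so this is the mean value inequality in the state variable at a fixed time.
-/
theorem SourceHyp.exists_lipschitz {D : ι → SpaceDisc K Y} {P : IBVP K Y} {T : ℝ}
    {u : ℝ → C(K, ℂ)} (h : SourceHyp D P T u) :
    ∃ r L : ℝ, 0 < r ∧ 0 ≤ L ∧ ∀ i, ∀ t ∈ Icc 0 T, ∀ U V : (D i).E,
      ‖U - (D i).projL (u t)‖ ≤ r → ‖V - (D i).projL (u t)‖ ≤ r →
      ‖(D i).fh t U - (D i).fh t V‖ ≤ L * ‖U - V‖ := by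
  obtain ⟨r, L, hr, hL⟩ := h.deriv_bound
  refine ⟨r, |L|, hr, abs_nonneg _, fun i t ht U V hU hV => ?_⟩
  have hd : Differentiable ℝ ((D i).fh t) := by
    have h1 : ContDiffOn ℝ 2 (fun x : (D i).E => (D i).fh t x) univ :=
      (h.contDiff i).comp (g := fun q : ℝ × (D i).E => (D i).fh q.1 q.2)
        (f := fun x : (D i).E => (t, x)) (contDiff_const.prodMk contDiff_id).contDiffOn
        fun x _ => ⟨ht, mem_univ _⟩
    exact (contDiffOn_univ.1 h1).differentiable (by norm_num)
  refine (convex_closedBall ((D i).proj (u t)) r).norm_image_sub_le_of_norm_fderiv_le (𝕜 := ℝ)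
    (fun x _ => hd x) (fun x hx => ?_) (mem_closedBall_iff_norm.2 hV) (mem_closedBall_iff_norm.2 hU)
  exact (hL i t ht x (mem_closedBall_iff_norm.1 hx)).trans (le_abs_self _)

/-- One application of the integrator for a time `τ ≤ τ₀`, from a value in the `r`-neighbourhood
of the solution, is compared with an approximate solution `z` of the nonlinear equation that
has a defect of at most `δ`. -/
def HalfStepBound (D : ι → SpaceDisc K Y) (P : IBVP K Y) (T : ℝ) (u : ℝ → C(K, ℂ))
    (Ψ : ∀ i, ℝ → ℝ → (D i).E → (D i).E) (r τ₀ C : ℝ) : Prop :=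
  ∀ i, ∀ t τ δ : ℝ, 0 ≤ t → 0 < τ → τ ≤ τ₀ → t + τ ≤ T →
    ∀ (y : (D i).E) (z z' : ℝ → C(K, ℂ)), ‖y - (D i).projL (u t)‖ ≤ r →
      (∀ s ∈ Icc 0 τ, HasDerivWithinAt z (z' s) (Icc 0 τ) s ∧ ‖z s - u (t + s)‖ ≤ r) →
      (∀ s ∈ Icc 0 τ, ‖P.f (t + s) (z s) - z' s‖ ≤ δ) →
      ‖Ψ i τ t y - (D i).projL (z τ) - (y - (D i).projL (z 0))‖
        ≤ C * (τ * ‖y - (D i).projL (z 0)‖ + τ * δ + τ ^ 3)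

/-- The exact flow from `y` is the intermediary: Picard-Lindelöf provides it on a time interval
independent of the discretization, the order of the integrator compares it with `Ψ`, and its
Lipschitz constant compares it with the approximate solution `z`. -/
theorem exists_halfStep_bound {D : ι → SpaceDisc K Y} {P : IBVP K Y} {T : ℝ}
    {u : ℝ → C(K, ℂ)} (h : SourceHyp D P T u) {Ψ : ∀ i, ℝ → ℝ → (D i).E → (D i).E} {p : ℕ}
    (hp : 2 ≤ p) (hΨ : HasOrder D T u Ψ p) {Λ M : ℝ}
    (hu : ∀ t ∈ Icc 0 T, ∀ s ∈ Icc 0 T, ‖u s - u t‖ ≤ Λ * |s - t|)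
    (hf : ∀ t ∈ Icc 0 T, ‖P.f t (u t)‖ ≤ M) :
    ∃ r τ₀ C : ℝ, 0 < r ∧ 0 < τ₀ ∧ 0 ≤ C ∧ HalfStepBound D P T u Ψ r τ₀ C := by
  obtain ⟨r₁, L, hr₁, hL, hlip⟩ := h.exists_lipschitz
  obtain ⟨r₂, τ₂, C, hr₂, hτ₂, hC⟩ := hΨ
  -- Starting within r₁/4 leaves the flow room to stay in the Lipschitz ball of radius r₁; r₂ is the
  -- range of the order condition.
  set r := min (r₁ / 4) r₂ with hr
  have hr0 : 0 < r := lt_min (by positivity) hr₂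
  have hB : 0 < |Λ| + (|M| + L * r₁) + 1 := by positivity
  have hL1 : 0 < 2 * L + 1 := by positivity
  -- In turn: the range of the order condition; τ ≤ 1, so that τ^(p+1) ≤ τ³; the time of existence
  -- of the flow; and τL ≤ 1/2 for the comparison.
  refine ⟨r, min (min τ₂ 1) (min (r₁ / 4 / (|Λ| + (|M| + L * r₁) + 1)) (1 / (2 * L + 1))),
    max |C| (max (2 * L) 2), hr0, ?_, by positivity, ?_⟩
  · refine lt_min (lt_min hτ₂ one_pos) (lt_min ?_ ?_) <;> positivity
  intro i t τ δ ht hτ hτle htT y z z' hy hz hd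
  simp only [le_min_iff] at hτle
  obtain ⟨⟨ha, hb⟩, hc, hdd⟩ := hτle
  rw [le_div_iff₀ hB] at hc
  rw [le_div_iff₀ hL1] at hdd
  have hmem : ∀ s ∈ Icc 0 τ, t + s ∈ Icc 0 T := fun s hs =>
    ⟨add_nonneg ht hs.1, (add_le_add_right hs.2 t).trans htT⟩
  have hlip' : ∀ s ∈ Icc 0 τ, ∀ x x' : (D i).E, ‖x - (D i).projL (u (t + s))‖ ≤ r₁ →
      ‖x' - (D i).projL (u (t + s))‖ ≤ r₁ →
      ‖(D i).fh (t + s) x - (D i).fh (t + s) x'‖ ≤ L * ‖x - x'‖ :=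
    fun s hs x x' hx hx' => hlip i _ (hmem s hs) x x' hx hx'
  obtain ⟨v, hv0, hv⟩ := exists_solution_near_curve (G := fun s x => (D i).fh (t + s) x)
    (c := fun s => (D i).projL (u (t + s))) (y := y) (τ := τ) (r := r₁) (L := L) (M := |M|)
    (Λ := Λ) hτ hr₁ hL (abs_nonneg M) hlip' (fun x => by
      refine ContinuousOn.comp (h.contDiff i).continuousOn
        (f := fun s : ℝ => (t + s, x)) (by fun_prop) fun s hs => ⟨hmem s hs, mem_univ _⟩)
    (fun s hs => by
      rw [← map_sub]
      refine ((D i).norm_projL_le _).trans ?_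
      have := hu (t + 0) (hmem 0 ⟨le_rfl, hτ.le⟩) (t + s) (hmem s hs)
      rwa [show t + s - (t + 0) = s by ring, abs_of_nonneg hs.1] at this)
    (fun s hs => by
      show ‖(D i).fh (t + s) ((D i).proj _)‖ ≤ |M|
      rw [← h.compatible i _ (hmem s hs)]
      exact ((D i).norm_projL_le _).trans ((hf _ (hmem s hs)).trans (le_abs_self _)))
    (by simpa using hy.trans (min_le_left _ _))
    (by nlinarith [mul_nonneg hτ.le (add_nonneg (abs_nonneg M) (mul_nonneg hL hr₁.le))])
    (by nlinarith [mul_nonneg hτ.le (abs_nonneg Λ)])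
  have hcmp := norm_solution_sub_approx_le (G := fun s x => (D i).fh (t + s) x)
    (c := fun s => (D i).projL (u (t + s))) (v := v) (z := fun s => (D i).projL (z s))
    (z' := fun s => (D i).projL (z' s)) (τ := τ) (r := r₁) (L := L) (δ := δ) hτ hL
    (by nlinarith) hlip' hv (fun s hs => ⟨((D i).projL.hasFDerivAt.comp_hasDerivWithinAt s
      (hz s hs).1), by
        rw [← map_sub]
        exact ((D i).norm_projL_le _).trans ((hz s hs).2.trans ((min_le_left _ _).trans
          (by linarith)))⟩)
    (fun s hs => by
      show ‖(D i).fh (t + s) ((D i).proj _) - _‖ ≤ δ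
      rw [← h.compatible i _ (hmem s hs), ← projL_apply, ← map_sub]
      exact ((D i).norm_projL_le _).trans (hd s hs))
  have hord := hC i t τ ht hτ ha htT y (hy.trans (min_le_right _ _)) v
    ⟨hv0, fun s hs => (hv s hs).1⟩
  rw [hv0] at hcmp
  have hδ : 0 ≤ δ := (norm_nonneg _).trans (hd 0 ⟨le_rfl, hτ.le⟩)
  have hpow : C * τ ^ (p + 1) ≤ |C| * τ ^ 3 :=
    (mul_le_mul_of_nonneg_right (le_abs_self C) (by positivity)).trans
      (mul_le_mul_of_nonneg_left (pow_le_pow_of_le_one hτ.le hb (by omega)) (abs_nonneg _))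
  have e1 : Ψ i τ t y - (D i).projL (z τ) - (y - (D i).projL (z 0))
      = (Ψ i τ t y - v τ) + (v τ - (D i).projL (z τ) - (y - (D i).projL (z 0))) := by abel
  rw [e1]
  refine (norm_add_le _ _).trans ?_
  set C' := max |C| (max (2 * L) 2)
  have hC1 : |C| * τ ^ 3 ≤ C' * τ ^ 3 :=
    mul_le_mul_of_nonneg_right (le_max_left _ _) (by positivity)
  have hC2 : 2 * L * (τ * ‖y - (D i).projL (z 0)‖) ≤ C' * (τ * ‖y - (D i).projL (z 0)‖) :=
    mul_le_mul_of_nonneg_right ((le_max_left _ _).trans (le_max_right _ _)) (by positivity)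
  have hC3 : 2 * (τ * δ) ≤ C' * (τ * δ) :=
    mul_le_mul_of_nonneg_right ((le_max_right _ _).trans (le_max_right _ _)) (by positivity)
  linarith

end SpaceDisc

/-! # Closedness of the boundary value problem -/

section Resolvent

variable {X : Type*} [NormedAddCommGroup X] [NormedSpace ℂ X]

/-- The resolvent of the generator is bounded. -/
theorem GeneratesSemigroup.exists_resolvent_bound {B : X →ₗ.[ℂ] X} {S : ℝ → X →L[ℂ] X} {ω : ℝ}
    (h : GeneratesSemigroup B S ω) {z : ℂ} (hz : ω < z.re) :
    ∃ C : ℝ, ∀ x : B.domain, ‖(x : X)‖ ≤ C * ‖z • (x : X) - B x‖ := by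
  obtain ⟨ω₁, h1, h2⟩ := exists_between hz
  obtain ⟨M, hM⟩ := h.growth ω₁ h1
  refine ⟨∫ t in Ioi (0 : ℝ), M * Real.exp ((ω₁ - z.re) * t), fun x => ?_⟩
  have hint : IntegrableOn (fun t : ℝ => M * Real.exp ((ω₁ - z.re) * t)) (Ioi 0) :=
    (integrableOn_exp_mul_Ioi (by linarith) 0).const_mul M
  conv_lhs => rw [← h.resolvent_left z hz x]
  rw [← integral_mul_const]
  refine norm_integral_le_of_norm_le (hint.mul_const _) ?_
  refine (ae_restrict_iff' measurableSet_Ioi).2 (Eventually.of_forall fun t ht => ?_)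
  rw [norm_smul, Complex.norm_exp]
  have e1 : (-(z * t)).re = -(z.re * t) := by simp
  have h3 := (S t).le_of_opNorm_le (hM t (le_of_lt ht)) (z • (x : X) - B x)
  rw [e1]
  calc _ ≤ Real.exp (-(z.re * t)) * (M * Real.exp (ω₁ * t) * ‖z • (x : X) - B x‖) :=
        mul_le_mul_of_nonneg_left h3 (Real.exp_pos _).le
    _ = M * (Real.exp (-(z.re * t)) * Real.exp (ω₁ * t)) * ‖z • (x : X) - B x‖ := by ring
    _ = _ := by rw [← Real.exp_add]; ring_nf

end Resolvent

namespace IBVP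

variable {K : Type*} [TopologicalSpace K] [CompactSpace K]
  {Y : Type*} [NormedAddCommGroup Y] [NormedSpace ℂ Y]

theorem app_coe (P : IBVP K Y) (x : P.A.domain) : P.app x = P.A x := by
  rw [app, dif_pos x.2]

theorem bdry_coe (P : IBVP K Y) (x : P.A.domain) : P.bdry x = P.bd x := by
  rw [bdry, dif_pos x.2]

theorem app_add (P : IBVP K Y) {x y : C(K, ℂ)} (hx : x ∈ P.A.domain) (hy : y ∈ P.A.domain) :
    P.app (x + y) = P.app x + P.app y := by
  lift x to P.A.domain using hx
  lift y to P.A.domain using hy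
  rw [← Submodule.coe_add, app_coe, app_coe, app_coe, LinearPMap.map_add]

theorem bdry_add (P : IBVP K Y) {x y : C(K, ℂ)} (hx : x ∈ P.A.domain) (hy : y ∈ P.A.domain) :
    P.bdry (x + y) = P.bdry x + P.bdry y := by
  lift x to P.A.domain using hx
  lift y to P.A.domain using hy
  rw [← Submodule.coe_add, bdry_coe, bdry_coe, bdry_coe, map_add]

theorem app_sub (P : IBVP K Y) {x y : C(K, ℂ)} (hx : x ∈ P.A.domain) (hy : y ∈ P.A.domain) :
    P.app (x - y) = P.app x - P.app y := by
  lift x to P.A.domain using hx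
  lift y to P.A.domain using hy
  rw [← Submodule.coe_sub, app_coe, app_coe, app_coe, LinearPMap.map_sub]

theorem bdry_sub (P : IBVP K Y) {x y : C(K, ℂ)} (hx : x ∈ P.A.domain) (hy : y ∈ P.A.domain) :
    P.bdry (x - y) = P.bdry x - P.bdry y := by
  lift x to P.A.domain using hx
  lift y to P.A.domain using hy
  rw [← Submodule.coe_sub, bdry_coe, bdry_coe, bdry_coe, map_sub]

theorem app_smul (P : IBVP K Y) (c : ℂ) {x : C(K, ℂ)} (hx : x ∈ P.A.domain) :
    P.app (c • x) = c • P.app x := by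
  lift x to P.A.domain using hx
  rw [← Submodule.coe_smul, app_coe, app_coe, LinearPMap.map_smul]

theorem bdry_smul (P : IBVP K Y) (c : ℂ) {x : C(K, ℂ)} (hx : x ∈ P.A.domain) :
    P.bdry (c • x) = c • P.bdry x := by
  lift x to P.A.domain using hx
  rw [← Submodule.coe_smul, bdry_coe, bdry_coe, map_smul]

theorem mem_A₀_domain {P : IBVP K Y} {x : C(K, ℂ)} :
    x ∈ P.A₀.domain ↔ x ∈ P.A.domain ∧ P.bdry x = 0 := by
  constructor
  · rintro ⟨⟨y, hy, rfl⟩, h⟩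
    exact ⟨h, (P.bdry_coe y).trans hy⟩
  · rintro ⟨h, h0⟩
    exact ⟨⟨⟨x, h⟩, (P.bdry_coe ⟨x, h⟩).symm.trans h0, rfl⟩, h⟩

theorem A₀_apply (P : IBVP K Y) (x : P.A₀.domain) : P.A₀ x = P.app x := by
  have hx : (x : C(K, ℂ)) ∈ P.A.domain := (mem_A₀_domain.1 x.2).1
  exact (LinearPMap.domRestrict_apply rfl).trans (P.app_coe ⟨x, hx⟩).symm

/-- The operators `A` and `∂` are jointly closed. -/
theorem StandingHyp.closed {P : IBVP K Y} {T : ℝ} {u : ℝ → C(K, ℂ)}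
    {S : ℝ → C(K, ℂ) →L[ℂ] C(K, ℂ)} {ω : ℝ} (hA : P.StandingHyp T u S ω)
    {α : Type*} {l : Filter α} [l.NeBot] {c : α → C(K, ℂ)} {x y : C(K, ℂ)} {v : Y}
    (hc : ∀ᶠ a in l, c a ∈ P.A.domain) (hx : Tendsto c l (𝓝 x))
    (hy : Tendsto (fun a => P.app (c a)) l (𝓝 y))
    (hv : Tendsto (fun a => P.bdry (c a)) l (𝓝 v)) :
    x ∈ P.A.domain ∧ P.app x = y ∧ P.bdry x = v := by
  obtain ⟨ω₀, C₀, hω₀, hC₀⟩ := hA.stationary_bound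
  -- A single point at which the stationary problem is solvable, its bound holds and the resolvent
  -- of `A₀` exists.
  set z : ℂ := ((max ω₀ 1 : ℝ) : ℂ) with hz
  have hzre : z.re = max ω₀ 1 := Complex.ofReal_re _
  have hz0 : 0 < z.re := by rw [hzre]; exact lt_of_lt_of_le one_pos (le_max_right _ _)
  have hzω : ω < z.re := by rw [hzre]; exact hω₀.trans_le (le_max_left _ _)
  choose k hk using fun v : Y => (hA.stationary z hz0 v).exists
  have hkapp : ∀ w, P.app (k w) = z • (k w : C(K, ℂ)) := fun w => (P.app_coe _).trans (hk w).1
  have hkbd : ∀ w, P.bdry (k w) = w := fun w => (P.bdry_coe _).trans (hk w).2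
  have hklip : ∀ w w' : Y, ‖(k w : C(K, ℂ)) - k w'‖ ≤ C₀ * ‖w - w'‖ := by
    intro w w'
    have h1 := hC₀ z (by rw [hzre]; exact le_max_left _ _) (k w - k w') (by
      rw [LinearPMap.map_sub, (hk w).1, (hk w').1, Submodule.coe_sub, smul_sub])
    rwa [map_sub, (hk w).2, (hk w').2] at h1
  have hkt : Tendsto (fun a => (k (P.bdry (c a)) : C(K, ℂ))) l (𝓝 (k v)) := by
    rw [tendsto_iff_norm_sub_tendsto_zero] at hv ⊢
    refine squeeze_zero (fun _ => norm_nonneg _) (fun a => hklip _ _) ?_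
    simpa using hv.const_mul C₀
  obtain ⟨C₁, hC₁⟩ := hA.generates.exists_resolvent_bound hzω
  obtain ⟨hw, hwz⟩ := hA.generates.resolvent_right z hzω (z • x - y)
  set w := ∫ t in Ioi (0 : ℝ), Complex.exp (-(z * t)) • S t (z • x - y) with hwdef
  rw [A₀_apply] at hwz
  have hwA := mem_A₀_domain.1 hw
  -- Subtracting the lift `k` of the boundary values gives an element of the domain of `A₀`. As z -
  -- A annihilates the lift, z - A maps the difference to z c - A c, and the bounded resolvent
  -- passes to the limit. The lift converges separately, by its Lipschitz bound.
  have hct : Tendsto (fun a => c a - k (P.bdry (c a))) l (𝓝 w) := by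
    rw [tendsto_iff_norm_sub_tendsto_zero]
    have hlim : Tendsto (fun a => C₁ * ‖(z • c a - P.app (c a)) - (z • x - y)‖) l (𝓝 0) := by
      have := tendsto_iff_norm_sub_tendsto_zero.1 ((hx.const_smul z).sub hy)
      simpa using this.const_mul C₁
    refine squeeze_zero' (Eventually.of_forall fun _ => norm_nonneg _) ?_ hlim
    filter_upwards [hc] with a ha
    have hm : c a - k (P.bdry (c a)) ∈ P.A₀.domain := mem_A₀_domain.2
      ⟨P.A.domain.sub_mem ha (k _).2, by rw [P.bdry_sub ha (k _).2, hkbd, sub_self]⟩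
    have h1 := hC₁ ⟨c a - k (P.bdry (c a)) - w, P.A₀.domain.sub_mem hm hw⟩
    have h2 : P.A₀ ⟨c a - k (P.bdry (c a)) - w, P.A₀.domain.sub_mem hm hw⟩
        = P.app (c a) - z • (k (P.bdry (c a)) : C(K, ℂ)) - P.app w := by
      rw [A₀_apply, P.app_sub (mem_A₀_domain.1 hm).1 hwA.1, P.app_sub ha (k _).2, hkapp]
    rw [h2] at h1
    refine h1.trans_eq ?_
    rw [← hwz]
    congr 2
    simp only [smul_sub]
    abel
  have hxe : x = w + k v := by
    have := tendsto_nhds_unique hct (hx.sub hkt)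
    rw [this]; abel
  have hxm : w + k v ∈ P.A.domain := P.A.domain.add_mem hwA.1 (k v).2
  refine ⟨hxe ▸ hxm, ?_, ?_⟩
  · have h1 : P.app x = P.app w + z • (k v : C(K, ℂ)) := by
      rw [hxe, P.app_add hwA.1 (k v).2, hkapp]
    have h2 : z • x = z • w + z • (k v : C(K, ℂ)) := by rw [← smul_add, ← hxe]
    have h3 : P.app w = z • w - (z • x - y) := by rw [← hwz]; abel
    rw [h1, h3, h2]; abel
  · rw [hxe, P.bdry_add hwA.1 (k v).2, hwA.2, hkbd, zero_add]

/-- Differentiation in time commutes with `A` and `∂`. -/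
theorem StandingHyp.hasDerivWithinAt {P : IBVP K Y} {T : ℝ} {u : ℝ → C(K, ℂ)}
    {S : ℝ → C(K, ℂ) →L[ℂ] C(K, ℂ)} {ω : ℝ} (hA : P.StandingHyp T u S ω) (hT : 0 < T)
    {c : ℝ → C(K, ℂ)} {c' a' : C(K, ℂ)} {g' : Y} {t : ℝ} (ht : t ∈ Icc 0 T)
    (hc : ∀ s ∈ Icc 0 T, c s ∈ P.A.domain) (h1 : HasDerivWithinAt c c' (Icc 0 T) t)
    (h2 : HasDerivWithinAt (fun s => P.app (c s)) a' (Icc 0 T) t)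
    (h3 : HasDerivWithinAt (fun s => P.bdry (c s)) g' (Icc 0 T) t) :
    P.app c' = a' ∧ P.bdry c' = g' := by
  rw [hasDerivWithinAt_iff_tendsto_slope] at h1 h2 h3
  have hne : (𝓝[Icc 0 T \ {t}] t).NeBot := by
    have := (uniqueDiffWithinAt_iff_accPt.1 (uniqueDiffOn_Icc hT t ht))
    rwa [accPt_principal_iff_nhdsWithin] at this
  have hmem : ∀ᶠ s in 𝓝[Icc 0 T \ {t}] t, s ∈ Icc 0 T :=
    eventually_mem_nhdsWithin.mono fun s hs => hs.1
  -- Closedness is applied to the difference quotients, on which A and ∂ act by linearity.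
  refine (hA.closed (l := 𝓝[Icc 0 T \ {t}] t) (c := slope c t) ?_ h1 ?_ ?_).2
  · filter_upwards [hmem] with s hs
    exact P.A.domain.smul_mem (((s - t)⁻¹ : ℝ) : ℂ) (P.A.domain.sub_mem (hc s hs) (hc t ht))
  · refine h2.congr' ?_
    filter_upwards [hmem] with s hs
    symm
    show P.app ((((s - t)⁻¹ : ℝ) : ℂ) • (c s - c t)) = _
    rw [P.app_smul _ (P.A.domain.sub_mem (hc s hs) (hc t ht)), P.app_sub (hc s hs) (hc t ht)]
    rfl
  · refine h3.congr' ?_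
    filter_upwards [hmem] with s hs
    symm
    show P.bdry ((((s - t)⁻¹ : ℝ) : ℂ) • (c s - c t)) = _
    rw [P.bdry_smul _ (P.A.domain.sub_mem (hc s hs) (hc t ht)), P.bdry_sub (hc s hs) (hc t ht)]
    exact Complex.coe_smul _ _

end IBVP

/-! # Expansions in time -/

section Calculus

variable {F G : Type*} [NormedAddCommGroup F] [NormedSpace ℝ F]
  [NormedAddCommGroup G] [NormedSpace ℝ G]

/-- A `C¹` function on a compact interval is bounded and Lipschitz. -/
theorem ContDiffOn.exists_bound_lipschitz {T : ℝ} (hT : 0 < T) {c : ℝ → F}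
    (hc : ContDiffOn ℝ 1 c (Icc 0 T)) :
    ∃ M : ℝ, 0 ≤ M ∧ (∀ t ∈ Icc 0 T, ‖c t‖ ≤ M) ∧
      ∀ t ∈ Icc 0 T, ∀ s ∈ Icc 0 T, ‖c s - c t‖ ≤ M * |s - t| := by
  obtain ⟨M₁, hM₁⟩ := isCompact_Icc.exists_bound_of_continuousOn hc.continuousOn
  obtain ⟨M₂, hM₂⟩ := isCompact_Icc.exists_bound_of_continuousOn
    (hc.continuousOn_derivWithin (uniqueDiffOn_Icc hT) (by norm_num))
  refine ⟨max 0 (max M₁ M₂), le_max_left _ _, fun t ht => (hM₁ t ht).trans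
    ((le_max_left _ _).trans (le_max_right _ _)), fun t ht s hs => ?_⟩
  exact (convex_Icc (0 : ℝ) T).norm_image_sub_le_of_norm_derivWithin_le
    (hc.differentiableOn (by norm_num))
    (fun x hx => (hM₂ x hx).trans ((le_max_right _ _).trans (le_max_right _ _))) ht hs

/-- Taylor expansion of order three for functions with Lipschitz second derivative. -/
theorem norm_taylor_two_le {T M : ℝ} {c c₁ c₂ : ℝ → F}
    (h1 : ∀ t ∈ Icc 0 T, HasDerivWithinAt c (c₁ t) (Icc 0 T) t)
    (h2 : ∀ t ∈ Icc 0 T, HasDerivWithinAt c₁ (c₂ t) (Icc 0 T) t)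
    (hM : ∀ t ∈ Icc 0 T, ∀ s ∈ Icc 0 T, ‖c₂ s - c₂ t‖ ≤ M * |s - t|) (hM0 : 0 ≤ M)
    {t k : ℝ} (ht : t ∈ Icc 0 T) (hk : 0 ≤ k) (htk : t + k ≤ T) :
    ‖c (t + k) - c t - k • c₁ t - (k ^ 2 / 2) • c₂ t‖ ≤ M * k ^ 3 := by
  have hsub : Icc t (t + k) ⊆ Icc 0 T := Icc_subset_Icc ht.1 htk
  have hl : t ∈ Icc t (t + k) := ⟨le_rfl, by linarith⟩
  have hr : t + k ∈ Icc t (t + k) := ⟨by linarith, le_rfl⟩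
  have step1 : ∀ s ∈ Icc t (t + k), ‖c₁ s - c₁ t - (s - t) • c₂ t‖ ≤ M * k ^ 2 := by
    intro s hs
    have hd : ∀ x ∈ Icc t (t + k), HasDerivWithinAt (fun x => c₁ x - (x - t) • c₂ t)
        (c₂ x - c₂ t) (Icc t (t + k)) x := by
      intro x hx
      have := ((h2 x (hsub hx)).mono hsub).sub
        ((((hasDerivAt_id x).sub_const t).smul_const (c₂ t)).hasDerivWithinAt
          (s := Icc t (t + k)))
      rw [one_smul] at this
      exact this
    have hb : ∀ x ∈ Icc t (t + k), ‖c₂ x - c₂ t‖ ≤ M * k := fun x hx =>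
      (hM t ht x (hsub hx)).trans (mul_le_mul_of_nonneg_left
        (by rw [abs_of_nonneg (by linarith [hx.1])]; linarith [hx.2]) hM0)
    have h3 := (convex_Icc t (t + k)).norm_image_sub_le_of_norm_hasDerivWithin_le hd hb hl hs
    simp only [sub_self, zero_smul, sub_zero] at h3
    have e1 : c₁ s - c₁ t - (s - t) • c₂ t = c₁ s - (s - t) • c₂ t - c₁ t := by abel
    rw [e1]
    refine h3.trans ?_
    rw [Real.norm_of_nonneg (by linarith [hs.1]), pow_two, ← mul_assoc]
    exact mul_le_mul_of_nonneg_left (by linarith [hs.2]) (by positivity)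
  have hd : ∀ x ∈ Icc t (t + k), HasDerivWithinAt
      (fun x => c x - (x - t) • c₁ t - ((x - t) ^ 2 / 2) • c₂ t)
      (c₁ x - c₁ t - (x - t) • c₂ t) (Icc t (t + k)) x := by
    intro x hx
    have e2 : HasDerivAt (fun x : ℝ => (x - t) ^ 2 / 2) (x - t) x := by
      have := (((hasDerivAt_id x).sub_const t).pow 2).div_const 2
      refine this.congr_deriv ?_
      simp
    have := (((h1 x (hsub hx)).mono hsub).sub
      ((((hasDerivAt_id x).sub_const t).smul_const (c₁ t)).hasDerivWithinAt
        (s := Icc t (t + k)))).sub ((e2.smul_const (c₂ t)).hasDerivWithinAt)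
    rw [one_smul] at this
    exact this
  have h3 := (convex_Icc t (t + k)).norm_image_sub_le_of_norm_hasDerivWithin_le hd step1 hl hr
  simp only [sub_self, zero_smul, sub_zero, add_sub_cancel_left, Real.norm_of_nonneg hk, ne_eq,
    OfNat.ofNat_ne_zero, not_false_eq_true, zero_pow, zero_div] at h3
  have e3 : c (t + k) - c t - k • c₁ t - (k ^ 2 / 2) • c₂ t
      = c (t + k) - k • c₁ t - (k ^ 2 / 2) • c₂ t - c t := by abel
  rw [e3]
  exact h3.trans_eq (by ring)

/-- Uniform second order Taylor estimate of a `C²` function near a compact curve. -/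
theorem exists_uniform_taylor {s : Set F} (hs : Convex ℝ s) (hs' : UniqueDiffOn ℝ s) {Φ : F → G}
    (hΦ : ContDiffOn ℝ 2 Φ s) {I : Set ℝ} (hI : IsCompact I) {γ : ℝ → F}
    (hγ : ContinuousOn γ I) (hγs : ∀ t ∈ I, γ t ∈ s) :
    ∃ δ C : ℝ, 0 < δ ∧ 0 ≤ C ∧ ∀ t ∈ I, ∀ x, γ t + x ∈ s → ‖x‖ ≤ δ →
      ‖Φ (γ t + x) - Φ (γ t) - fderivWithin ℝ Φ s (γ t) x‖ ≤ C * ‖x‖ ^ 2 := by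
  suffices h : ∃ δ C : ℝ, 0 < δ ∧ 0 ≤ C ∧ ∀ t ∈ I ∩ I, ∀ x, γ t + x ∈ s → ‖x‖ ≤ δ →
      ‖Φ (γ t + x) - Φ (γ t) - fderivWithin ℝ Φ s (γ t) x‖ ≤ C * ‖x‖ ^ 2 by
    simpa using h
  refine hI.induction_on (p := fun J => ∃ δ C : ℝ, 0 < δ ∧ 0 ≤ C ∧ ∀ t ∈ J ∩ I, ∀ x,
    γ t + x ∈ s → ‖x‖ ≤ δ →
      ‖Φ (γ t + x) - Φ (γ t) - fderivWithin ℝ Φ s (γ t) x‖ ≤ C * ‖x‖ ^ 2) ?_ ?_ ?_ ?_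
  · exact ⟨1, 0, one_pos, le_rfl, fun t ht => absurd ht.1 (notMem_empty t)⟩
  · rintro J J' hJ ⟨δ, C, hδ, hC, h⟩
    exact ⟨δ, C, hδ, hC, fun t ht => h t ⟨hJ ht.1, ht.2⟩⟩
  · rintro J J' ⟨δ, C, hδ, hC, h⟩ ⟨δ', C', hδ', hC', h'⟩
    refine ⟨min δ δ', max C C', lt_min hδ hδ', hC.trans (le_max_left _ _), ?_⟩
    rintro t ⟨ht | ht, htI⟩ x hx hxδ
    · exact (h t ⟨ht, htI⟩ x hx (hxδ.trans (min_le_left _ _))).trans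
        (mul_le_mul_of_nonneg_right (le_max_left _ _) (by positivity))
    · exact (h' t ⟨ht, htI⟩ x hx (hxδ.trans (min_le_right _ _))).trans
        (mul_le_mul_of_nonneg_right (le_max_right _ _) (by positivity))
  · intro t₀ ht₀
    have h1 : ContDiffWithinAt ℝ 1 (fderivWithin ℝ Φ s) s (γ t₀) :=
      (hΦ.fderivWithin hs' (by norm_num)) _ (hγs t₀ ht₀)
    obtain ⟨L, U, hU, hL⟩ := h1.exists_lipschitzOnWith hs
    obtain ⟨ρ, hρ, hρU⟩ := Metric.mem_nhdsWithin_iff.1 hU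
    refine ⟨{t | γ t ∈ Metric.ball (γ t₀) (ρ / 2)}, ?_, ρ / 4, L, by positivity, L.2, ?_⟩
    · exact (hγ t₀ ht₀) (Metric.ball_mem_nhds _ (by positivity))
    rintro t ⟨ht, htI⟩ x hx hxρ
    -- The ball around γ t₀ makes the derivative Lipschitz on V, and the closed ball around γ t
    -- limits its variation to L‖x‖; V is convex, so the mean value inequality yields the quadratic
    -- bound.
    set V := s ∩ (Metric.ball (γ t₀) ρ ∩ Metric.closedBall (γ t) ‖x‖) with hV
    have hVs : V ⊆ s := inter_subset_left
    have hVU : V ⊆ U := fun y hy => hρU ⟨hy.2.1, hy.1⟩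
    have hVc : Convex ℝ V := hs.inter ((convex_ball _ _).inter (convex_closedBall _ _))
    have ht1 : dist (γ t) (γ t₀) < ρ / 2 := ht
    have hγV : γ t ∈ V := ⟨hγs t htI, Metric.mem_ball.2 (by linarith), by simp⟩
    have hxV : γ t + x ∈ V := by
      refine ⟨hx, Metric.mem_ball.2 ?_, by simp⟩
      have := dist_triangle (γ t + x) (γ t) (γ t₀)
      simp only [dist_self_add_left] at this
      linarith
    have h2 := hVc.norm_image_sub_le_of_norm_hasFDerivWithin_le' (f := Φ)
      (f' := fderivWithin ℝ Φ s) (φ := fderivWithin ℝ Φ s (γ t)) (C := L * ‖x‖)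
      (fun y hy => ((hΦ.differentiableOn (by norm_num) y (hVs hy)).hasFDerivWithinAt).mono hVs)
      (fun y hy => by
        have h3 := hL.norm_sub_le (hVU hy) (hVU hγV)
        refine h3.trans (mul_le_mul_of_nonneg_left ?_ L.2)
        exact mem_closedBall_iff_norm.1 hy.2.2) hγV hxV
    rw [add_sub_cancel_left] at h2
    exact h2.trans_eq (by ring)

/-- Consequence of a second order Taylor estimate for an increment that is known up to terms of
second order. -/
theorem norm_sub_linear_part_le {s : Set (ℝ × F)} {Φ : ℝ × F → F} {t : ℝ} {x₀ a φ : F}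
    {L : ℝ × F →L[ℝ] F} {δ C N k σ κ ρ μ : ℝ}
    (htay : ∀ x, (t, x₀) + x ∈ s → ‖x‖ ≤ δ →
      ‖Φ ((t, x₀) + x) - Φ (t, x₀) - L x‖ ≤ C * ‖x‖ ^ 2)
    (hL : ‖L‖ ≤ N) (ha : ‖a‖ ≤ N) (hφ : ‖φ‖ ≤ N) (hf : ‖L (1, φ)‖ ≤ N) (hq : ‖L (0, a)‖ ≤ N)
    (hC : 0 ≤ C) (hk : 0 ≤ k) (hk1 : k ≤ 1) (hk2 : k * (1 + 4 * N) ≤ δ)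
    (hmem : (t + σ, x₀ + κ • a + σ • φ + ρ • L (1, φ) + μ • L (0, a)) ∈ s)
    (hσ : |σ| ≤ k) (hκ : |κ| ≤ k) (hρ : |ρ| ≤ k ^ 2) (hμ : |μ| ≤ k ^ 2) :
    ‖Φ (t + σ, x₀ + κ • a + σ • φ + ρ • L (1, φ) + μ • L (0, a))
      - (Φ (t, x₀) + σ • L (1, φ) + κ • L (0, a))‖ ≤ (2 * N * N + C * (1 + 4 * N) ^ 2) * k ^ 2 := by
  have hN0 : 0 ≤ N := (norm_nonneg _).trans hL
  have hkk : k ^ 2 ≤ k := by nlinarith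
  have nsm : ∀ {c m : ℝ} {w : F}, |c| ≤ m → ‖w‖ ≤ N → ‖c • w‖ ≤ m * N := fun hc hw => by
    rw [norm_smul, Real.norm_eq_abs]
    exact mul_le_mul hc hw (norm_nonneg _) ((abs_nonneg _).trans hc)
  have b1 := nsm hκ ha
  have b2 := nsm hσ hφ
  have b3 := nsm hρ hf
  have b4 := nsm hμ hq
  set f₂ := L (1, φ) with hf₂
  set q := L (0, a) with hq'
  set w := ρ • f₂ + μ • q with hw
  have bw : ‖w‖ ≤ k ^ 2 * (2 * N) := (norm_add_le _ _).trans (by linarith)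
  have hb : ‖κ • a + σ • φ + w‖ ≤ k * (4 * N) := by
    have h1 := norm_add_le (κ • a + σ • φ) w
    have h2 := norm_add_le (κ • a) (σ • φ)
    have h3 := mul_le_mul_of_nonneg_right hkk hN0
    linarith
  have e1 : x₀ + κ • a + σ • φ + ρ • f₂ + μ • q = x₀ + (κ • a + σ • φ + w) := by
    rw [hw]; abel
  rw [e1] at hmem ⊢
  set y := κ • a + σ • φ + w with hy
  have bx : ‖(σ, y)‖ ≤ k * (1 + 4 * N) := by
    rw [Prod.norm_def]
    have := mul_nonneg hk hN0
    exact max_le (hσ.trans (by linarith)) (hb.trans (by linarith))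
  have h1 := htay (σ, y) hmem (bx.trans hk2)
  -- The part w of the increment is already O(k²), so its image under the derivative belongs to the
  -- error; it contributes 2N·N to the constant.
  have e2 : L (σ, y) = σ • f₂ + κ • q + L (0, w) := by
    rw [hf₂, hq', ← map_smul, ← map_smul, ← map_add, ← map_add]
    congr 1
    ext
    · simp
    · simp only [Prod.smul_mk, Prod.mk_add_mk, hy]
      abel
  have h2 : ‖L (0, w)‖ ≤ N * (k ^ 2 * (2 * N)) := by
    refine (ContinuousLinearMap.le_opNorm _ _).trans (mul_le_mul hL ?_ (norm_nonneg _) hN0)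
    rw [Prod.norm_def]
    exact max_le (by simpa using by positivity) bw
  rw [e2] at h1
  have e3 : Φ (t + σ, x₀ + y) - (Φ (t, x₀) + σ • f₂ + κ • q)
      = (Φ ((t, x₀) + (σ, y)) - Φ (t, x₀) - (σ • f₂ + κ • q + L (0, w))) + L (0, w) := by
    rw [Prod.mk_add_mk]
    abel
  rw [e3]
  have h3 : ‖(σ, y)‖ ^ 2 ≤ (k * (1 + 4 * N)) ^ 2 := pow_le_pow_left₀ (norm_nonneg _) bx 2
  have h4 := mul_le_mul_of_nonneg_left h3 hC
  refine (norm_add_le _ _).trans ((add_le_add (h1.trans h4) h2).trans_eq ?_)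
  ring

end Calculus

/-! ### Second order expansion of the solution and of the source along it -/

namespace IBVP

variable {K : Type*} [TopologicalSpace K] [CompactSpace K]
  {Y : Type*} [NormedAddCommGroup Y] [NormedSpace ℂ Y]

/-- The expansions of the solution and of the source term on which the local error depends;
`f₂` stands for `(f_t + f_u f)(t, u(t))` and `q` for `f_u(t, u(t)) A u(t)`. -/
structure IsExpansion (P : IBVP K Y) (T : ℝ) (u f₂ q : ℝ → C(K, ℂ)) (M k₀ : ℝ) :
    Prop where
  nonneg : 0 ≤ M
  pos : 0 < k₀
  bound : ∀ t ∈ Icc 0 T, ‖u t‖ ≤ M ∧ ‖P.app (u t)‖ ≤ M ∧ ‖P.f t (u t)‖ ≤ M ∧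
    ‖P.app (P.app (u t))‖ ≤ M ∧ ‖P.app (P.f t (u t))‖ ≤ M ∧ ‖f₂ t‖ ≤ M ∧ ‖q t‖ ≤ M
  lipschitz : ∀ t ∈ Icc 0 T, ∀ s ∈ Icc 0 T, ‖u s - u t‖ ≤ M * |s - t| ∧
    ‖P.app (P.app (u s)) - P.app (P.app (u t))‖ ≤ M * |s - t| ∧
    ‖P.app (P.f s (u s)) - P.app (P.f t (u t))‖ ≤ M * |s - t| ∧ ‖f₂ s - f₂ t‖ ≤ M * |s - t|
  solution : ∀ t ∈ Icc 0 T, ∀ k : ℝ, 0 ≤ k → t + k ≤ T →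
    ‖u (t + k) - u t - k • (P.app (u t) + P.f t (u t))
      - (k ^ 2 / 2) • (P.app (P.app (u t)) + P.app (P.f t (u t)) + f₂ t + q t)‖ ≤ M * k ^ 3
  source : ∀ t ∈ Icc 0 T, ∀ k σ κ ρ μ : ℝ, 0 ≤ k → k ≤ k₀ → t + σ ∈ Icc 0 T →
    |σ| ≤ k → |κ| ≤ k → |ρ| ≤ k ^ 2 → |μ| ≤ k ^ 2 →
    ‖P.f (t + σ) (u t + κ • P.app (u t) + σ • P.f t (u t) + ρ • f₂ t + μ • q t)
      - (P.f t (u t) + σ • f₂ t + κ • q t)‖ ≤ M * k ^ 2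

-- Time differentiation commutes with A and ∂ along u. Together with the equation this yields g' and
-- u'' = A²u + Af + f₂ + q. The expansions are then Taylor estimates, uniform by compactness of the
-- curve (t, u(t)).
set_option maxHeartbeats 1000000 in
theorem exists_expansion {P : IBVP K Y} {T : ℝ} (hT : 0 < T) {u : ℝ → C(K, ℂ)}
    (hu : P.IsSolution T u) {S : ℝ → C(K, ℂ) →L[ℂ] C(K, ℂ)} {ω : ℝ}
    (hA : P.StandingHyp T u S ω) (hreg : P.ExtraRegularity T u) :
    (∀ t ∈ Icc 0 T, derivWithin P.g (Icc 0 T) t = P.bdry (P.app (u t)) + P.bdry (P.f t (u t))) ∧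
    ∃ (f₂ q : ℝ → C(K, ℂ)) (M k₀ : ℝ), P.IsExpansion T u f₂ q M k₀ := by
  have hI := uniqueDiffOn_Icc hT
  set I := Icc (0 : ℝ) T with hIdef
  -- the derivative of `u` and the compatibility with `A` and `∂`
  have hder : ∀ t ∈ I, P.app (derivWithin u I t) = derivWithin (fun s => P.app (u s)) I t
      ∧ P.bdry (derivWithin u I t) = derivWithin P.g I t := by
    intro t ht
    refine hA.hasDerivWithinAt hT ht hu.mem_domain
      ((hu.equation t ht).differentiableWithinAt.hasDerivWithinAt)
      ((hA.Au_contDiff.differentiableOn (by norm_num)) t ht).hasDerivWithinAt ?_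
    exact (((hA.g_contDiff.differentiableOn (by norm_num)) t ht).hasDerivWithinAt).congr
      (fun s hs => hu.boundary s hs) (hu.boundary t ht)
  have hu' : ∀ t ∈ I, derivWithin u I t = P.app (u t) + P.f t (u t) := fun t ht =>
    (hu.equation t ht).derivWithin (hI t ht)
  have hA2 : ∀ t ∈ I, derivWithin (fun s => P.app (u s)) I t
      = P.app (P.app (u t)) + P.app (P.f t (u t)) := fun t ht => by
    rw [← (hder t ht).1, hu' t ht, P.app_add (hA.Au_mem t ht) (hA.fu_mem t ht)]
  refine ⟨fun t ht => by
    rw [← (hder t ht).2, hu' t ht, P.bdry_add (hA.Au_mem t ht) (hA.fu_mem t ht)], ?_⟩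
  -- smoothness
  set s := I ×ˢ (univ : Set C(K, ℂ)) with hs
  set Φ : ℝ × C(K, ℂ) → C(K, ℂ) := fun p => P.f p.1 p.2 with hΦ
  have hsu : UniqueDiffOn ℝ s := hI.prod uniqueDiffOn_univ
  have hsc : Convex ℝ s := (convex_Icc 0 T).prod convex_univ
  have hcurve : ContDiffOn ℝ 3 (fun t => (t, u t)) I :=
    contDiffOn_id.prodMk (hreg.u_contDiff.of_le (by norm_num))
  have hmaps : MapsTo (fun t => (t, u t)) I s := fun t ht => ⟨ht, mem_univ _⟩
  have hφ : ContDiffOn ℝ 3 (fun t => P.f t (u t)) I := hreg.f_contDiff.comp hcurve hmaps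
  have hdu : ContDiffOn ℝ 3 (fun t => P.app (u t) + P.f t (u t)) I :=
    (hreg.u_contDiff.derivWithin hI (by norm_num)).congr fun t ht => (hu' t ht).symm
  have hAu : ContDiffOn ℝ 3 (fun t => P.app (u t)) I :=
    (hdu.sub hφ).congr fun t ht => by simp
  have hddu : ContDiffOn ℝ 1 (derivWithin (fun t => P.app (u t) + P.f t (u t)) I) I :=
    hdu.derivWithin hI (by norm_num)
  have hdΦ : ContDiffOn ℝ 1 (fun t => fderivWithin ℝ Φ s (t, u t)) I :=
    (hreg.f_contDiff.fderivWithin (m := 1) hsu (by norm_num)).comp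
      (hcurve.of_le (by norm_num)) hmaps
  set f₂ : ℝ → C(K, ℂ) := fun t => fderivWithin ℝ Φ s (t, u t) (1, P.f t (u t)) with hf₂
  set q : ℝ → C(K, ℂ) := fun t => fderivWithin ℝ Φ s (t, u t) (0, P.app (u t)) with hq
  have hf₂c : ContDiffOn ℝ 1 f₂ I :=
    hdΦ.clm_apply (contDiffOn_const.prodMk (hφ.of_le (by norm_num)))
  have hqc : ContDiffOn ℝ 1 q I :=
    hdΦ.clm_apply (contDiffOn_const.prodMk (hAu.of_le (by norm_num)))
  have hφ' : ∀ t ∈ I, HasDerivWithinAt (fun t => P.f t (u t)) (f₂ t + q t) I t := by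
    intro t ht
    have h1 : HasFDerivWithinAt Φ (fderivWithin ℝ Φ s (t, u t)) s (t, u t) :=
      ((hreg.f_contDiff.differentiableOn (by norm_num)) _ (hmaps ht)).hasFDerivWithinAt
    have h2 := h1.comp_hasDerivWithinAt t
      ((hasDerivWithinAt_id t I).prodMk (hu.equation t ht)) hmaps
    have e1 : f₂ t + q t = fderivWithin ℝ Φ s (t, u t) (1, P.app (u t) + P.f t (u t)) := by
      rw [hf₂, hq, ← map_add]
      simp [add_comm]
    rw [e1]
    exact h2
  have hdd : ∀ t ∈ I, HasDerivWithinAt (fun t => P.app (u t) + P.f t (u t))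
      (P.app (P.app (u t)) + P.app (P.f t (u t)) + f₂ t + q t) I t := by
    intro t ht
    have h1 := ((hA.Au_contDiff.differentiableOn (by norm_num)) t ht).hasDerivWithinAt
    rw [hA2 t ht] at h1
    have := h1.add (hφ' t ht)
    rwa [← add_assoc] at this
  have hddu' : ContDiffOn ℝ 1
      (fun t => P.app (P.app (u t)) + P.app (P.f t (u t)) + f₂ t + q t) I :=
    hddu.congr fun t ht => ((hdd t ht).derivWithin (hI t ht)).symm
  -- The standing hypotheses give only continuity of Af(t, u(t)); here it is isolated from the
  -- formula for u'', whose other terms are C¹.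
  have hb : ContDiffOn ℝ 1 (fun t => P.app (P.f t (u t))) I :=
    (((hddu'.sub hA.AAu_contDiff).sub hf₂c).sub hqc).congr fun t ht => by
      abel
  -- constants
  obtain ⟨M₁, hM₁0, hM₁, hM₁'⟩ := (hreg.u_contDiff.of_le (by norm_num)).exists_bound_lipschitz hT
  obtain ⟨M₂, hM₂0, hM₂, -⟩ := hA.Au_contDiff.exists_bound_lipschitz hT
  obtain ⟨M₃, hM₃0, hM₃, -⟩ := (hφ.of_le (by norm_num)).exists_bound_lipschitz hT
  obtain ⟨M₄, hM₄0, hM₄, hM₄'⟩ := hA.AAu_contDiff.exists_bound_lipschitz hT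
  obtain ⟨M₅, hM₅0, hM₅, hM₅'⟩ := hb.exists_bound_lipschitz hT
  obtain ⟨M₆, hM₆0, hM₆, hM₆'⟩ := hf₂c.exists_bound_lipschitz hT
  obtain ⟨M₇, hM₇0, hM₇, -⟩ := hqc.exists_bound_lipschitz hT
  obtain ⟨M₈, hM₈0, -, hM₈⟩ := hddu'.exists_bound_lipschitz hT
  obtain ⟨M₉, hM₉0, hM₉, -⟩ := hdΦ.exists_bound_lipschitz hT
  obtain ⟨δ, C, hδ, hC, htay⟩ := exists_uniform_taylor hsc hsu
    (hreg.f_contDiff.of_le (by norm_num)) (isCompact_Icc (a := (0 : ℝ)) (b := T))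
    hcurve.continuousOn hmaps
  set N := M₁ + M₂ + M₃ + M₄ + M₅ + M₆ + M₇ + M₈ + M₉ with hN
  have hN0 : 0 ≤ N := by positivity
  have hNM : N ≤ N + 2 * N * N + C * (1 + 4 * N) ^ 2 := by
    have : 0 ≤ 2 * N * N + C * (1 + 4 * N) ^ 2 := by positivity
    linarith
  have hlipN : ∀ {m : ℝ} {x y : ℝ}, m ≤ N → m * |x - y|
      ≤ (N + 2 * N * N + C * (1 + 4 * N) ^ 2) * |x - y| := fun h =>
    mul_le_mul_of_nonneg_right (h.trans hNM) (abs_nonneg _)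
  -- The threshold δ/(1 + 4N) keeps the increment in (t, u), of size at most k(1 + 4N), within the
  -- range of the Taylor estimate.
  refine ⟨f₂, q, N + 2 * N * N + C * (1 + 4 * N) ^ 2, min 1 (δ / (1 + 4 * N)),
    hN0.trans hNM, lt_min one_pos (by positivity), fun t ht => ?_, fun t ht x hx => ?_,
    fun t ht k hk htk => ?_, ?_⟩
  · refine ⟨(hM₁ t ht).trans ?_, (hM₂ t ht).trans ?_, (hM₃ t ht).trans ?_, (hM₄ t ht).trans ?_,
      (hM₅ t ht).trans ?_, (hM₆ t ht).trans ?_, (hM₇ t ht).trans ?_⟩ <;> linarith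
  · refine ⟨(hM₁' t ht x hx).trans (hlipN ?_), (hM₄' t ht x hx).trans (hlipN ?_),
      (hM₅' t ht x hx).trans (hlipN ?_), (hM₆' t ht x hx).trans (hlipN ?_)⟩ <;> linarith
  · refine (norm_taylor_two_le (fun t ht => hu.equation t ht) hdd hM₈ hM₈0 ht hk htk).trans ?_
    exact mul_le_mul_of_nonneg_right (by linarith) (by positivity)
  · intro t ht k σ κ ρ μ hk hkle htσ hσ hκ hρ hμ
    refine (norm_sub_linear_part_le (x₀ := u t) (Φ := Φ) (htay t ht) ((hM₉ t ht).trans (by linarith))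
      ((hM₂ t ht).trans (by linarith)) ((hM₃ t ht).trans (by linarith))
      ((hM₆ t ht).trans (by linarith)) ((hM₇ t ht).trans (by linarith)) hC hk
      (hkle.trans (min_le_left _ _))
      ((le_div_iff₀ (by positivity)).1 (hkle.trans (min_le_right _ _)))
      ⟨htσ, mem_univ _⟩ hσ hκ hρ hμ).trans ?_
    exact mul_le_mul_of_nonneg_right (by linarith) (by positivity)

end IBVP

/-! # The local error -/

/-- The linear step of the modified splitting, with the boundary terms expressed by consistency
errors. -/
theorem strang_linear_step_eq {E : Type*} [NormedAddCommGroup E] [NormedSpace ℂ E]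
    {B e J₁ J₂ : E →L[ℂ] E} {k : ℝ} (h1 : J₁ * B = e - 1) (h2 : J₂ * B = J₁ - k • 1)
    (V U F A₁ A₂ G d₀ d₁ d₂ c : E) :
    e V + J₁ (A₁ - B U + B d₀ + (k / 2) • (G - B F + d₂ + B c))
        + J₂ (A₂ - B A₁ + d₁ + (G - B F + d₂) - (G - B F + d₂ + B c)) - (U + k • A₁ + (k / 2) • F)
      = e (V - U - (k / 2) • F) + (k / 2) • J₁ G + J₂ A₂ + (e d₀ - d₀)
        + ((k / 2) • J₁ d₂ + J₂ d₁ + ((k / 2) • (e c - c) - (J₁ c - k • c))) := by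
  have hs : ∀ (L : E →L[ℂ] E) (r : ℝ) (x : E), L (r • x) = r • L x := fun L r x =>
    L.map_smul_of_tower r x
  have e1 : ∀ x, J₁ (B x) = e x - x := fun x => congrArg (fun L : E →L[ℂ] E => L x) h1
  have e2 : ∀ x, J₂ (B x) = J₁ x - k • x := fun x => congrArg (fun L : E →L[ℂ] E => L x) h2
  -- Every `B` stands directly under `J₁` or `J₂` and disappears; what remains is linear algebra in
  -- the other vectors.
  simp only [map_add, map_sub, hs, e1, e2]
  module

namespace SpaceDisc

variable {K : Type*} [TopologicalSpace K] [CompactSpace K]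
  {Y : Type*} [NormedAddCommGroup Y] [NormedSpace ℂ Y] {ι : Type*}

/-- The definition of the elliptic projection solved for the boundary term. The last summand is the
consistency error; the first two combine with the φ-recurrences. -/
theorem Ch_bdry_eq {D : SpaceDisc K Y} (hD : IsUnit D.Ah) (P : IBVP K Y) (x : C(K, ℂ)) :
    D.Ch (P.bdry x) = D.projL (P.app x) - D.Ah (D.projL x)
      + D.Ah (D.projL x - D.ellProj P x) := by
  have h : D.Ah (D.ellProj P x) = D.projL (P.app x) - D.Ch (P.bdry x) := by
    have := Ring.mul_inverse_cancel D.Ah hD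
    exact congrArg (fun L : D.E →L[ℂ] D.E => L (D.projL (P.app x) - D.Ch (P.bdry x))) this
  rw [map_sub, h]
  abel

/-- The first half step. -/
theorem norm_first_halfStep_le {P : IBVP K Y} {T : ℝ} {u f₂ q : ℝ → C(K, ℂ)} {M k₀ : ℝ}
    (hE : P.IsExpansion T u f₂ q M k₀) {D : ι → SpaceDisc K Y}
    {Ψ : ∀ i, ℝ → ℝ → (D i).E → (D i).E} {r τ₀ C : ℝ}
    (hH : HalfStepBound D P T u Ψ r τ₀ C)
    (hC : 0 ≤ C)
    (i : ι) {t k : ℝ} (ht : 0 ≤ t) (hk : 0 < k) (htk : t + k ≤ T) (hk₀ : k ≤ k₀) (hk1 : k ≤ 1)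
    (hkτ : k ≤ τ₀) (hkr : 5 * M * k ≤ r) {U : (D i).E} (hU : ‖U - (D i).projL (u t)‖ ≤ r) :
    ‖Ψ i (k / 2) t U - (D i).projL (u t) - (k / 2) • (D i).projL (P.f t (u t))
        - (k ^ 2 / 8) • (D i).projL (f₂ t) - (U - (D i).projL (u t))‖
      ≤ C * (k * ‖U - (D i).projL (u t)‖ + (M + 1) * k ^ 3) := by
  have htI : t ∈ Icc 0 T := ⟨ht, by linarith⟩
  have hM := hE.nonneg
  obtain ⟨bu, ba, bφ, -, -, bf, bq⟩ := hE.bound t htI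
  have hkk : k ^ 2 ≤ k := by nlinarith
  -- Taylor polynomial of the nonlinear flow from u(t). The zero coefficients are kept so that the
  -- form matches `IsExpansion.source`.
  set z : ℝ → C(K, ℂ) := fun s => u t + (0 : ℝ) • P.app (u t) + s • P.f t (u t)
    + (s ^ 2 / 2) • f₂ t + (0 : ℝ) • q t with hz
  set z' : ℝ → C(K, ℂ) := fun s => P.f t (u t) + s • f₂ t + (0 : ℝ) • q t with hz'
  have hmem : ∀ s ∈ Icc (0 : ℝ) (k / 2), t + s ∈ Icc 0 T := fun s hs =>
    ⟨by linarith [hs.1], by linarith [hs.2]⟩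
  have h := hH i t (k / 2) (M * k ^ 2) ht (by linarith) (by linarith) (by linarith) U z z' hU
    (fun s hs => ⟨?_, ?_⟩) (fun s hs => ?_)
  · have e0 : z 0 = u t := by simp [hz]
    have e1 : z (k / 2) = u t + (k / 2) • P.f t (u t) + (k ^ 2 / 8) • f₂ t := by
      simp only [hz, zero_smul, add_zero]
      congr 2
      ring
    rw [e0, e1, map_add, map_add, map_smul, map_smul] at h
    have e2 : ∀ a b c d f : (D i).E, a - b - c - d - f = a - (b + c + d) - f := by
      intros; abel
    rw [e2]
    refine h.trans (mul_le_mul_of_nonneg_left ?_ hC)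
    have h1 : 0 ≤ k * ‖U - (D i).projL (u t)‖ := by positivity
    have h2 : 0 ≤ M * k ^ 3 := by positivity
    have h3 : 0 ≤ k ^ 3 := by positivity
    nlinarith
  · have h1 : HasDerivAt (fun s : ℝ => s ^ 2 / 2) s s := by
      refine ((hasDerivAt_pow 2 s).div_const 2).congr_deriv ?_
      simp
    have h2 := ((((hasDerivAt_id s).smul_const (P.f t (u t))).const_add
      (u t + (0 : ℝ) • P.app (u t))).add (h1.smul_const (f₂ t))).add_const ((0 : ℝ) • q t)
    refine (h2.congr_deriv ?_).hasDerivWithinAt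
    simp [hz']
  · have h1 := (hE.lipschitz t htI _ (hmem s hs)).1
    rw [add_sub_cancel_left, abs_of_nonneg hs.1] at h1
    have e1 : z s - u (t + s) = s • P.f t (u t) + (s ^ 2 / 2) • f₂ t - (u (t + s) - u t) := by
      simp only [hz, zero_smul, add_zero]; abel
    have hs2 : s ≤ k := by linarith [hs.2]
    have h2 : ‖s • P.f t (u t)‖ ≤ k * M := by
      rw [norm_smul, Real.norm_of_nonneg hs.1]
      exact mul_le_mul hs2 bφ (norm_nonneg _) hk.le
    have h3 : ‖(s ^ 2 / 2) • f₂ t‖ ≤ k * M := by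
      rw [norm_smul, Real.norm_of_nonneg (by positivity)]
      exact mul_le_mul (by nlinarith [hs.1]) bf (norm_nonneg _) hk.le
    have h4 : M * s ≤ M * k := mul_le_mul_of_nonneg_left hs2 hM
    rw [e1]
    refine (norm_sub_le _ _).trans ((add_le_add (norm_add_le _ _) le_rfl).trans ?_)
    nlinarith [mul_nonneg hM hk.le]
  · have hs2 : s ≤ k := by linarith [hs.2]
    refine hE.source t htI k s 0 (s ^ 2 / 2) 0 hk.le hk₀ (hmem s hs) ?_ ?_ ?_ ?_
    · rwa [abs_of_nonneg hs.1]
    · simpa using hk.le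
    · rw [abs_of_nonneg (by positivity)]; nlinarith [hs.1]
    · simpa using by positivity

/-- The second half step. -/
theorem norm_second_halfStep_le {P : IBVP K Y} {T : ℝ} {u f₂ q : ℝ → C(K, ℂ)} {M k₀ : ℝ}
    (hE : P.IsExpansion T u f₂ q M k₀) {D : ι → SpaceDisc K Y}
    {Ψ : ∀ i, ℝ → ℝ → (D i).E → (D i).E} {r τ₀ C : ℝ}
    (hH : HalfStepBound D P T u Ψ r τ₀ C)
    (hC : 0 ≤ C)
    (i : ι) {t k : ℝ} (ht : 0 ≤ t) (hk : 0 < k) (htk : t + k ≤ T) (hk₀ : k ≤ k₀) (hk1 : k ≤ 1)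
    (hkτ : k ≤ τ₀) (hkr : 5 * M * k ≤ r) {W Z : (D i).E}
    (hWZ : W - ((D i).projL (u t) + k • (D i).projL (P.app (u t))
      + (k / 2) • (D i).projL (P.f t (u t))) = Z) (hZr : ‖Z‖ + 3 * M * k ≤ r) :
    ‖Ψ i (k / 2) (t + k / 2) W - (D i).projL (u (t + k))
        + (k ^ 2 / 2) • ((D i).projL (P.app (P.app (u t))) + (D i).projL (P.app (P.f t (u t))))
        + (k ^ 2 / 8) • (D i).projL (f₂ t) - Z‖
      ≤ C * (k * ‖Z‖ + (M + 1) * k ^ 3) + M * k ^ 3 := by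
  have htI : t ∈ Icc 0 T := ⟨ht, by linarith⟩
  have hM := hE.nonneg
  obtain ⟨bu, ba, bφ, -, -, bf, bq⟩ := hE.bound t htI
  have hkk : k ^ 2 ≤ k := by nlinarith
  have hkM : 0 ≤ k * M := by positivity
  -- Expansion of the nonlinear flow started at time t + k/2 from u + kAu + (k/2)f. All second order
  -- terms of the preceding steps are left in `Z`.
  set z : ℝ → C(K, ℂ) := fun s => u t + k • P.app (u t) + (k / 2 + s) • P.f t (u t)
    + (k / 2 * s + s ^ 2 / 2) • f₂ t + (k * s) • q t with hz
  set z' : ℝ → C(K, ℂ) := fun s => P.f t (u t) + (k / 2 + s) • f₂ t + k • q t with hz'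
  have hmem : ∀ s ∈ Icc (0 : ℝ) (k / 2), t + k / 2 + s ∈ Icc 0 T := fun s hs =>
    ⟨by linarith [hs.1], by linarith [hs.2]⟩
  have hsm : ∀ {c : ℝ} {w : C(K, ℂ)}, 0 ≤ c → c ≤ k → ‖w‖ ≤ M → ‖c • w‖ ≤ k * M :=
    fun h0 hc hw => by
      rw [norm_smul, Real.norm_of_nonneg h0]
      exact mul_le_mul hc hw (norm_nonneg _) hk.le
  have e0 : z 0 = u t + k • P.app (u t) + (k / 2) • P.f t (u t) := by simp [hz]
  have hW0 : W - (D i).projL (z 0) = Z := by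
    rw [e0, map_add, map_add, map_smul, map_smul, hWZ]
  have hWr : ‖W - (D i).projL (u (t + k / 2))‖ ≤ r := by
    have h1 := (hE.lipschitz t htI (t + k / 2) ⟨by linarith, by linarith⟩).1
    rw [add_sub_cancel_left, abs_of_pos (by linarith : 0 < k / 2)] at h1
    have e1 : W - (D i).projL (u (t + k / 2)) = Z + (D i).projL (k • P.app (u t)
        + (k / 2) • P.f t (u t) - (u (t + k / 2) - u t)) := by
      rw [← hW0, e0]
      simp only [map_add, map_sub]
      abel
    have h2 : ‖k • P.app (u t) + (k / 2) • P.f t (u t) - (u (t + k / 2) - u t)‖ ≤ 3 * M * k := by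
      refine (norm_sub_le _ _).trans ((add_le_add (norm_add_le _ _) le_rfl).trans ?_)
      have := hsm hk.le le_rfl ba
      have := hsm (by linarith : 0 ≤ k / 2) (by linarith) bφ
      linarith
    rw [e1]
    exact (norm_add_le _ _).trans ((add_le_add le_rfl (((D i).norm_projL_le _).trans h2)).trans hZr)
  have h := hH i (t + k / 2) (k / 2) (M * k ^ 2) (by linarith) (by linarith) (by linarith)
    (by linarith) W z z' hWr (fun s hs => ⟨?_, ?_⟩) (fun s hs => ?_)
  · rw [hW0] at h
    have e1 : z (k / 2) = u t + k • P.app (u t) + k • P.f t (u t) + (3 * k ^ 2 / 8) • f₂ t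
        + (k ^ 2 / 2) • q t := by
      simp only [hz]
      rw [add_halves, show k / 2 * (k / 2) + (k / 2) ^ 2 / 2 = 3 * k ^ 2 / 8 by ring,
        show k * (k / 2) = k ^ 2 / 2 by ring]
    have hτ := hE.solution t htI k hk.le htk
    set R := u (t + k) - u t - k • (P.app (u t) + P.f t (u t))
      - (k ^ 2 / 2) • (P.app (P.app (u t)) + P.app (P.f t (u t)) + f₂ t + q t) with hR
    -- The coefficient of f₂ is 3k²/8 in `z` and k²/2 in the solution. The missing k²/8 is later
    -- paired with the k²/8 produced by the first half step.
    have e2 : z (k / 2) = u (t + k) - R - (k ^ 2 / 2) • (P.app (P.app (u t))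
        + P.app (P.f t (u t))) - (k ^ 2 / 8) • f₂ t := by
      rw [e1, hR]
      module
    have e3 : Ψ i (k / 2) (t + k / 2) W - (D i).projL (u (t + k))
        + (k ^ 2 / 2) • ((D i).projL (P.app (P.app (u t))) + (D i).projL (P.app (P.f t (u t))))
        + (k ^ 2 / 8) • (D i).projL (f₂ t) - Z
        = (Ψ i (k / 2) (t + k / 2) W - (D i).projL (z (k / 2)) - Z) - (D i).projL R := by
      rw [e2]
      simp only [map_sub, map_add, map_smul]
      abel
    rw [e3]
    refine (norm_sub_le _ _).trans (add_le_add (h.trans (mul_le_mul_of_nonneg_left ?_ hC))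
      (((D i).norm_projL_le _).trans hτ))
    have h1 : 0 ≤ k * ‖Z‖ := by positivity
    have h2 : 0 ≤ M * k ^ 3 := by positivity
    have h3 : 0 ≤ k ^ 3 := by positivity
    nlinarith
  · have h1 : HasDerivAt (fun s : ℝ => k / 2 * s + s ^ 2 / 2) (k / 2 + s) s := by
      refine (((hasDerivAt_id s).const_mul (k / 2)).add
        ((hasDerivAt_pow 2 s).div_const 2)).congr_deriv ?_
      simp
    have h3 : HasDerivAt (fun s : ℝ => k * s) k s := by
      simpa using (hasDerivAt_id s).const_mul k
    have h2 := (((((hasDerivAt_id s).const_add (k / 2)).smul_const (P.f t (u t))).const_add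
      (u t + k • P.app (u t))).add (h1.smul_const (f₂ t))).add (h3.smul_const (q t))
    refine (h2.congr_deriv ?_).hasDerivWithinAt
    simp [hz']
  · have h1 := (hE.lipschitz t htI _ (hmem s hs)).1
    rw [show t + k / 2 + s - t = k / 2 + s by ring,
      abs_of_nonneg (by linarith [hs.1] : 0 ≤ k / 2 + s)] at h1
    have e1 : z s - u (t + k / 2 + s) = k • P.app (u t) + (k / 2 + s) • P.f t (u t)
        + (k / 2 * s + s ^ 2 / 2) • f₂ t + (k * s) • q t - (u (t + k / 2 + s) - u t) := by
      simp only [hz]; abel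
    have hs2 : s ≤ k / 2 := hs.2
    have hs0 : 0 ≤ s := hs.1
    have g1 := hsm hk.le le_rfl ba
    have g2 := hsm (by linarith : 0 ≤ k / 2 + s) (by linarith) bφ
    have g3 := hsm (by positivity : 0 ≤ k / 2 * s + s ^ 2 / 2) (by nlinarith) bf
    have g4 := hsm (by positivity : 0 ≤ k * s) (by nlinarith) bq
    have g5 : M * (k / 2 + s) ≤ M * k := mul_le_mul_of_nonneg_left (by linarith) hM
    rw [e1]
    have n1 := norm_sub_le (k • P.app (u t) + (k / 2 + s) • P.f t (u t)
        + (k / 2 * s + s ^ 2 / 2) • f₂ t + (k * s) • q t) (u (t + k / 2 + s) - u t)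
    have n2 := norm_add_le (k • P.app (u t) + (k / 2 + s) • P.f t (u t)
        + (k / 2 * s + s ^ 2 / 2) • f₂ t) ((k * s) • q t)
    have n3 := norm_add_le (k • P.app (u t) + (k / 2 + s) • P.f t (u t))
        ((k / 2 * s + s ^ 2 / 2) • f₂ t)
    have n4 := norm_add_le (k • P.app (u t)) ((k / 2 + s) • P.f t (u t))
    linarith
  · have hs2 : s ≤ k / 2 := hs.2
    have hs0 : 0 ≤ s := hs.1
    rw [show t + k / 2 + s = t + (k / 2 + s) by ring]
    refine hE.source t htI k (k / 2 + s) k (k / 2 * s + s ^ 2 / 2) (k * s) hk.le hk₀ ?_ ?_ ?_ ?_ ?_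
    · rw [← add_assoc]; exact hmem s hs
    · rw [abs_of_nonneg (by linarith)]; linarith
    · rw [abs_of_pos hk]
    · rw [abs_of_nonneg (by positivity)]; nlinarith
    · rw [abs_of_nonneg (by positivity)]; nlinarith

end SpaceDisc

/-! ### Consistency errors along the solution and the form of the local error -/

namespace SpaceDisc

variable {K : Type*} [TopologicalSpace K] [CompactSpace K]
  {Y : Type*} [NormedAddCommGroup Y] [NormedSpace ℂ Y] {ι : Type*}

/-- The error of the elliptic projection. -/
noncomputable def ellErr (D : SpaceDisc K Y) (P : IBVP K Y) (x : C(K, ℂ)) : D.E :=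
  D.projL x - D.ellProj P x

theorem ellErr_sub (D : SpaceDisc K Y) {P : IBVP K Y} {x y : C(K, ℂ)} (hx : x ∈ P.A.domain)
    (hy : y ∈ P.A.domain) : D.ellErr P (x - y) = D.ellErr P x - D.ellErr P y := by
  have h : D.ellProj P (x - y) = D.ellProj P x - D.ellProj P y := by
    simp only [ellProj, P.app_sub hx hy, P.bdry_sub hx hy, ← projL_apply, map_sub]
    abel
  rw [ellErr, ellErr, ellErr, h, map_sub]
  abel

/-- The consistency errors along the solution. -/
structure ConsistentAlong (D : ι → SpaceDisc K Y) (P : IBVP K Y) (T : ℝ) (u : ℝ → C(K, ℂ))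
    (ε η : ι → ℝ) (N : ℝ) : Prop where
  nonneg : 0 ≤ N
  eps : ∀ i, ∀ t ∈ Icc 0 T, ‖(D i).Ah ((D i).ellErr P (P.app (u t)))‖ ≤ ε i * N ∧
    ‖(D i).Ah ((D i).ellErr P (P.f t (u t)))‖ ≤ ε i * N
  eta : ∀ i, ∀ t ∈ Icc 0 T, ‖(D i).ellErr P (u t)‖ ≤ η i * N
  eta_lipschitz : ∀ i, ∀ t ∈ Icc 0 T, ∀ s ∈ Icc 0 T,
    ‖(D i).ellErr P (u s) - (D i).ellErr P (u t)‖ ≤ η i * (N * |s - t|)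

/-- Regularity C¹ into Z bounds the Z-norms and the Z-Lipschitz constants uniformly in time. The
elliptic error is additive, so the η-bound applies to differences as well. -/
theorem Consistent.exists_along {Z : Type*} [NormedAddCommGroup Z] [NormedSpace ℂ Z]
    {D : ι → SpaceDisc K Y} {P : IBVP K Y} {S : ℝ → C(K, ℂ) →L[ℂ] C(K, ℂ)}
    {j : Z →ₗ[ℂ] C(K, ℂ)} {ε η : ι → ℝ} (h : Consistent D P S j ε η) (hε : ∀ i, 0 ≤ ε i)
    (hη : ∀ i, 0 ≤ η i) {T : ℝ} (hT : 0 < T) {u : ℝ → C(K, ℂ)}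
    (hreg : P.ExtraRegularityZ T u j) : ∃ N, ConsistentAlong D P T u ε η N := by
  obtain ⟨w₁, hw₁, hw₁'⟩ := hreg.u_mem
  obtain ⟨w₂, hw₂, hw₂'⟩ := hreg.Au_mem
  obtain ⟨w₃, hw₃, hw₃'⟩ := hreg.fu_mem
  obtain ⟨N₁, hN₁, h₁, h₁'⟩ := hw₁.exists_bound_lipschitz hT
  obtain ⟨N₂, hN₂, h₂, -⟩ := hw₂.exists_bound_lipschitz hT
  obtain ⟨N₃, hN₃, h₃, -⟩ := hw₃.exists_bound_lipschitz hT
  refine ⟨N₁ + N₂ + N₃, by positivity, fun i t ht => ⟨?_, ?_⟩, fun i t ht => ?_,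
    fun i t ht s hs => ?_⟩
  · have e1 : P.app (u t) = j (w₂ t) := (hw₂' t ht).symm
    rw [e1]
    exact (h.consistent_eps i (w₂ t)).trans
      (mul_le_mul_of_nonneg_left ((h₂ t ht).trans (by linarith)) (hε i))
  · have e1 : P.f t (u t) = j (w₃ t) := (hw₃' t ht).symm
    rw [e1]
    exact (h.consistent_eps i (w₃ t)).trans
      (mul_le_mul_of_nonneg_left ((h₃ t ht).trans (by linarith)) (hε i))
  · rw [← hw₁' t ht]
    exact (h.consistent_eta i (w₁ t)).trans
      (mul_le_mul_of_nonneg_left ((h₁ t ht).trans (by linarith)) (hη i))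
  · rw [← hw₁' t ht, ← hw₁' s hs, ← ellErr_sub _ (h.mem_domain _) (h.mem_domain _), ← map_sub]
    exact (h.consistent_eta i (w₁ s - w₁ t)).trans
      (mul_le_mul_of_nonneg_left ((h₁' t ht s hs).trans
        (mul_le_mul_of_nonneg_right (by linarith) (abs_nonneg _))) (hη i))

/-- The leading part of the local error. -/
noncomputable def leadingError (D : SpaceDisc K Y) (P : IBVP K Y) (u f₂ : ℝ → C(K, ℂ))
    (k t : ℝ) : D.E :=
  (1 - NormedSpace.exp (k • D.Ah)) (-((k ^ 2 / 8) • D.projL (f₂ t) + D.ellErr P (u t)))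
    + (k • (1 : D.E →L[ℂ] D.E) - k ^ 1 • phiOp 1 k D.Ah) (-((k / 2) • D.projL (P.app (P.f t (u t)))))
    + ((k ^ 2 / 2) • (1 : D.E →L[ℂ] D.E) - k ^ 2 • phiOp 2 k D.Ah) (-(D.projL (P.app (P.app (u t)))))

-- Terms of sizes k² and η without a further factor k are kept exactly: e^{kB} from the linear step
-- pairs with the deficits of the second half step to form the cancelling operators of
-- `leadingError`. Everything else is bounded by `X`.
set_option maxHeartbeats 2000000 in
theorem norm_local_error_le {P : IBVP K Y} {T : ℝ} {u f₂ q : ℝ → C(K, ℂ)} {M k₀ : ℝ}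
    (hE : P.IsExpansion T u f₂ q M k₀)
    (hb : ∀ t ∈ Icc 0 T, P.bdry (u t) = P.g t)
    (hg : ∀ t ∈ Icc 0 T,
      derivWithin P.g (Icc 0 T) t = P.bdry (P.app (u t)) + P.bdry (P.f t (u t)))
    {D : ι → SpaceDisc K Y} (hD : Stable D) {Ψ : ∀ i, ℝ → ℝ → (D i).E → (D i).E} {r τ₀ C : ℝ}
    (hH : HalfStepBound D P T u Ψ r τ₀ C) (hC : 0 ≤ C) {ε η : ι → ℝ} {N : ℝ}
    (hN : ConsistentAlong D P T u ε η N) {c : ℝ} (hc : 0 ≤ c) {R : ℝ}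
    (hR : R = C + C * (M + 1) + 2 * N + 3 * c)
    (i : ι) (hε : 0 ≤ ε i) (hη : 0 ≤ η i) {t k : ℝ} (ht : 0 ≤ t) (hk : 0 < k) (htk : t + k ≤ T)
    (hk₀ : k ≤ k₀) (hk1 : k ≤ 1) (hkτ : k ≤ τ₀) (hkr : 5 * M * k ≤ r)
    {U : (D i).E} (Cs : ℝ → (D i).E → (D i).E)
    (hCs : ‖Ring.inverse (D i).Ah (Cs t U - (D i).Ch (P.bdry (P.f t (u t))))‖
      ≤ c * ‖U - (D i).projL (u t)‖) {X : ℝ}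
    (hX : X = k ^ 3 + k ^ 2 * ε i + k * η i + k * ‖U - (D i).projL (u t)‖)
    (hUr : ‖U - (D i).projL (u t)‖ + R * X + 3 * M * k ^ 2 + 2 * N * η i + 3 * M * k ≤ r) :
    ‖(D i).strangStep P T (Ψ i) Cs k t U - (D i).projL (u (t + k))
        - (NormedSpace.exp (k • (D i).Ah) (U - (D i).projL (u t))
          + (D i).leadingError P u f₂ k t)‖
      ≤ (R + C * (R + 4 * M + 2 + 2 * N) + M) * X := by
  have htI : t ∈ Icc 0 T := ⟨ht, by linarith⟩
  have hM := hE.nonneg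
  have hN0 := hN.nonneg
  obtain ⟨-, -, -, ba2, bb, bf, -⟩ := hE.bound t htI
  obtain ⟨hd₁, hd₂⟩ := hN.eps i t htI
  have hd₀ := hN.eta i t htI
  have hexp := hD.contractive i
  have hB := hD.isUnit i
  have hinv := Ring.mul_inverse_cancel (D i).Ah hB
  set e := NormedSpace.exp (k • (D i).Ah) with he
  set J₁ := k ^ 1 • phiOp 1 k (D i).Ah with hJ₁
  set J₂ := k ^ 2 • phiOp 2 k (D i).Ah with hJ₂
  have hJ1 : J₁ * (D i).Ah = e - 1 := phiOp_one_mul hk _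
  have hJ2 : J₂ * (D i).Ah = J₁ - k • 1 := by
    refine (phiOp_succ_mul le_rfl hk (D i).Ah).trans ?_
    simp only [pow_one, Nat.factorial_one, Nat.cast_one, div_one, hJ₁]
  have ne : ∀ x, ‖e x‖ ≤ ‖x‖ := fun x => by
    simpa using e.le_of_opNorm_le (hexp k hk.le) x
  have nJ1 : ∀ x, ‖J₁ x‖ ≤ k * ‖x‖ := fun x => by
    simpa using J₁.le_of_opNorm_le (norm_pow_smul_phiOp_le le_rfl hk hexp) x
  have nJ2 : ∀ x, ‖J₂ x‖ ≤ k ^ 2 * ‖x‖ := fun x =>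
    J₂.le_of_opNorm_le (norm_pow_smul_phiOp_le (by norm_num) hk hexp) x
  set V := Ψ i (k / 2) t U with hV
  set U₀ := (D i).projL (u t) with hU₀
  set F := (D i).projL (P.f t (u t)) with hF
  set A₁ := (D i).projL (P.app (u t)) with hA₁
  set A₂ := (D i).projL (P.app (P.app (u t))) with hA₂
  set G := (D i).projL (P.app (P.f t (u t))) with hG
  set F₂ := (D i).projL (f₂ t) with hF₂
  set d₀ := (D i).ellErr P (u t) with hd₀'
  set d₁ := (D i).Ah ((D i).ellErr P (P.app (u t))) with hd₁'
  set d₂ := (D i).Ah ((D i).ellErr P (P.f t (u t))) with hd₂'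
  set b := Ring.inverse (D i).Ah (Cs t U - (D i).Ch (P.bdry (P.f t (u t)))) with hb'
  have hBb : Cs t U = G - (D i).Ah F + d₂ + (D i).Ah b := by
    have h1 : (D i).Ah b = Cs t U - (D i).Ch (P.bdry (P.f t (u t))) :=
      congrArg (fun L : (D i).E →L[ℂ] (D i).E =>
        L (Cs t U - (D i).Ch (P.bdry (P.f t (u t))))) hinv
    rw [h1, Ch_bdry_eq hB P]
    simp only [hG, hF, hd₂', ellErr]
    abel
  have hCg : (D i).Ch (P.g t) = A₁ - (D i).Ah U₀ + (D i).Ah d₀ := by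
    rw [← hb t htI, Ch_bdry_eq hB P]; rfl
  have hCg' : (D i).Ch (derivWithin P.g (Icc 0 T) t)
      = A₂ - (D i).Ah A₁ + d₁ + (G - (D i).Ah F + d₂) := by
    rw [hg t htI, map_add, Ch_bdry_eq hB P, Ch_bdry_eq hB P]; rfl
  set W : (D i).E := e V + J₁ ((D i).Ch (P.g t) + (k / 2) • Cs t U)
    + J₂ ((D i).Ch (derivWithin P.g (Icc 0 T) t) - Cs t U) with hW
  have hstep : (D i).strangStep P T (Ψ i) Cs k t U = Ψ i (k / 2) (t + k / 2) W := by
    rw [hW, hJ₁, pow_one]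
    rfl
  have hWe := strang_linear_step_eq hJ1 hJ2 V U₀ F A₁ A₂ G d₀ d₁ d₂ b
  rw [← hBb, ← hCg, ← hCg', ← hW] at hWe
  have hV1 := norm_first_halfStep_le hE hH hC i ht hk htk hk₀ hk1 hkτ hkr (U := U) (by
    have : 0 ≤ R * X := by rw [hR, hX]; positivity
    have : 0 ≤ 3 * M * k ^ 2 + 2 * N * η i + 3 * M * k := by positivity
    linarith)
  rw [← hV, ← hU₀, ← hF, ← hF₂] at hV1
  set x := U - U₀ with hx
  set ρ := V - U₀ - (k / 2) • F - (k ^ 2 / 8) • F₂ - x with hρ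
  set rem := e ρ + ((k / 2) • J₁ d₂ + J₂ d₁ + ((k / 2) • (e b - b) - (J₁ b - k • b))) with hrem
  set Z := W - (U₀ + k • A₁ + (k / 2) • F) with hZ
  have hsr : ∀ (L : (D i).E →L[ℂ] (D i).E) (r : ℝ) (x : (D i).E), L (r • x) = r • L x :=
    fun L r x => L.map_smul_of_tower r x
  have hZe : Z = e x + ((k ^ 2 / 8) • e F₂ + (k / 2) • J₁ G + J₂ A₂ + (e d₀ - d₀)) + rem := by
    have h1 : V - U₀ - (k / 2) • F = x + (k ^ 2 / 8) • F₂ + ρ := by rw [hρ]; abel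
    rw [hWe, h1, hrem, map_add, map_add, hsr]
    abel
  -- bounds
  have hkε : 0 ≤ k ^ 2 * ε i := by positivity
  have hkη : 0 ≤ k * η i := by positivity
  have hk3 : 0 ≤ k ^ 3 := by positivity
  have hkx : 0 ≤ k * ‖x‖ := by positivity
  have hX0 : 0 ≤ X := by rw [hX]; positivity
  have X1 : k ^ 3 ≤ X := by linarith
  have X2 : k ^ 2 * ε i ≤ X := by linarith
  have X3 : k * η i ≤ X := by linarith
  have X4 : k * ‖x‖ ≤ X := by linarith
  have X5 : C * (k * ‖x‖) ≤ C * X := mul_le_mul_of_nonneg_left X4 hC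
  have X6 : C * (M + 1) * k ^ 3 ≤ C * (M + 1) * X :=
    mul_le_mul_of_nonneg_left X1 (by positivity)
  -- The summands of R: C and C(M + 1) from the first half step, 2N from the consistency errors `d₁`
  -- and `d₂`, 3c from the error `b` of the boundary correction.
  have hrem' : ‖rem‖ ≤ R * X := by
    have n1 : ‖e ρ‖ ≤ C * (k * ‖x‖ + (M + 1) * k ^ 3) := (ne ρ).trans hV1
    have n2 : ‖(k / 2) • J₁ d₂‖ ≤ k ^ 2 * ε i * N := by
      rw [norm_smul, Real.norm_of_nonneg (by positivity)]
      calc k / 2 * ‖J₁ d₂‖ ≤ k * (k * (ε i * N)) :=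
            mul_le_mul (by linarith) ((nJ1 d₂).trans (mul_le_mul_of_nonneg_left hd₂ hk.le))
              (norm_nonneg _) hk.le
        _ = _ := by ring
    have n3 : ‖J₂ d₁‖ ≤ k ^ 2 * ε i * N :=
      ((nJ2 d₁).trans (mul_le_mul_of_nonneg_left hd₁ (by positivity))).trans_eq (by ring)
    have n4 : ‖(k / 2) • (e b - b)‖ ≤ k * (c * ‖x‖) := by
      rw [norm_smul, Real.norm_of_nonneg (by positivity)]
      have := (norm_sub_le (e b) b).trans (add_le_add (ne b) le_rfl)
      have := mul_le_mul_of_nonneg_left (this.trans (add_le_add hCs hCs))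
        (by positivity : 0 ≤ k / 2)
      linarith
    have n5 : ‖J₁ b - k • b‖ ≤ 2 * (k * (c * ‖x‖)) := by
      have h1 := norm_sub_le (J₁ b) (k • b)
      rw [norm_smul, Real.norm_of_nonneg hk.le] at h1
      have h2 := nJ1 b
      have h3 := mul_le_mul_of_nonneg_left hCs hk.le
      linarith
    have m1 := norm_add_le (e ρ)
      ((k / 2) • J₁ d₂ + J₂ d₁ + ((k / 2) • (e b - b) - (J₁ b - k • b)))
    have m2 := norm_add_le ((k / 2) • J₁ d₂ + J₂ d₁) ((k / 2) • (e b - b) - (J₁ b - k • b))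
    have m3 := norm_add_le ((k / 2) • J₁ d₂) (J₂ d₁)
    have m4 := norm_sub_le ((k / 2) • (e b - b)) (J₁ b - k • b)
    have p1 : k ^ 2 * ε i * N ≤ X * N := mul_le_mul_of_nonneg_right X2 hN0
    have p2 : c * (k * ‖x‖) ≤ c * X := mul_le_mul_of_nonneg_left X4 hc
    rw [hR]
    linarith
  have hlead : ‖(k ^ 2 / 8) • e F₂ + (k / 2) • J₁ G + J₂ A₂ + (e d₀ - d₀)‖
      ≤ 3 * M * k ^ 2 + 2 * N * η i := by
    have n0 : ∀ y, ‖(D i).projL y‖ ≤ ‖y‖ := (D i).norm_projL_le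
    have n1 : ‖(k ^ 2 / 8) • e F₂‖ ≤ M * k ^ 2 := by
      rw [norm_smul, Real.norm_of_nonneg (by positivity), mul_comm M]
      exact mul_le_mul (by nlinarith) ((ne _).trans ((n0 _).trans bf)) (norm_nonneg _)
        (by positivity)
    have n2 : ‖(k / 2) • J₁ G‖ ≤ M * k ^ 2 := by
      rw [norm_smul, Real.norm_of_nonneg (by positivity)]
      calc k / 2 * ‖J₁ G‖ ≤ k * (k * M) :=
            mul_le_mul (by linarith) ((nJ1 G).trans (mul_le_mul_of_nonneg_left
              ((n0 _).trans bb) hk.le)) (norm_nonneg _) hk.le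
        _ = _ := by ring
    have n3 : ‖J₂ A₂‖ ≤ M * k ^ 2 :=
      ((nJ2 A₂).trans (mul_le_mul_of_nonneg_left ((n0 _).trans ba2) (by positivity))).trans_eq
        (by ring)
    have n4 : ‖e d₀ - d₀‖ ≤ 2 * (η i * N) :=
      (norm_sub_le _ _).trans (by linarith [ne d₀])
    have m1 := norm_add_le ((k ^ 2 / 8) • e F₂ + (k / 2) • J₁ G + J₂ A₂) (e d₀ - d₀)
    have m2 := norm_add_le ((k ^ 2 / 8) • e F₂ + (k / 2) • J₁ G) (J₂ A₂)
    have m3 := norm_add_le ((k ^ 2 / 8) • e F₂) ((k / 2) • J₁ G)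
    linarith
  have hZn : ‖Z‖ ≤ ‖x‖ + (3 * M * k ^ 2 + 2 * N * η i) + R * X := by
    rw [hZe]
    refine (norm_add_le _ _).trans (add_le_add ((norm_add_le _ _).trans
      (add_le_add (ne x) hlead)) hrem')
  -- The bound on ‖Z‖ just obtained plus 3Mk is the left-hand side of `hUr`.
  have h2 := norm_second_halfStep_le hE hH hC i ht hk htk hk₀ hk1 hkτ hkr (W := W) (Z := Z) rfl
    (by linarith)
  rw [← hA₂, ← hG, ← hF₂, ← hstep] at h2
  have hfin : (D i).strangStep P T (Ψ i) Cs k t U - (D i).projL (u (t + k))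
        - (e x + (D i).leadingError P u f₂ k t)
      = ((D i).strangStep P T (Ψ i) Cs k t U - (D i).projL (u (t + k))
        + (k ^ 2 / 2) • (A₂ + G) + (k ^ 2 / 8) • F₂ - Z) + rem := by
    have h3 : (D i).leadingError P u f₂ k t
        = -((k ^ 2 / 8) • F₂ + d₀) + ((k ^ 2 / 8) • e F₂ + e d₀)
          - (k * (k / 2)) • G + (k / 2) • J₁ G - (k ^ 2 / 2) • A₂ + J₂ A₂ := by
      have h4 : (D i).leadingError P u f₂ k t
          = (-((k ^ 2 / 8) • F₂ + d₀) - e (-((k ^ 2 / 8) • F₂ + d₀)))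
            + (k • (-((k / 2) • G)) - J₁ (-((k / 2) • G)))
            + ((k ^ 2 / 2) • (-A₂) - J₂ (-A₂)) := rfl
      rw [h4]
      simp only [map_neg, map_add, hsr]
      module
    rw [h3, hZe]
    module
  rw [hfin]
  refine (norm_add_le _ _).trans ((add_le_add h2 hrem').trans ?_)
  have k1 : k * ‖Z‖ ≤ X + 3 * M * X + 2 * N * X + R * X := by
    have h3 := mul_le_mul_of_nonneg_left hZn hk.le
    have hRX : 0 ≤ R * X := (norm_nonneg _).trans hrem'
    have h4 : k * (R * X) ≤ R * X := mul_le_of_le_one_left hRX hk1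
    have h5 : 3 * M * k ^ 3 ≤ 3 * M * X := mul_le_mul_of_nonneg_left X1 (by positivity)
    have h6 : 2 * N * (k * η i) ≤ 2 * N * X := mul_le_mul_of_nonneg_left X3 (by positivity)
    nlinarith
  have k2 : C * (k * ‖Z‖) ≤ C * (X + 3 * M * X + 2 * N * X + R * X) :=
    mul_le_mul_of_nonneg_left k1 hC
  have k3 : M * k ^ 3 ≤ M * X := mul_le_mul_of_nonneg_left X1 hM
  linarith

end SpaceDisc

/-! ### Accumulation of the local errors -/

namespace SpaceDisc

variable {K : Type*} [TopologicalSpace K] [CompactSpace K]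
  {Y : Type*} [NormedAddCommGroup Y] [NormedSpace ℂ Y] {ι : Type*}

/-- The leading parts of the local errors accumulate without loss of an order. -/
theorem norm_sum_leadingError_le {P : IBVP K Y} {T : ℝ} {u f₂ q : ℝ → C(K, ℂ)} {M k₀ : ℝ}
    (hE : P.IsExpansion T u f₂ q M k₀) {D : ι → SpaceDisc K Y} (hD : Stable D) {ε η : ι → ℝ} {N : ℝ}
    (hN : ConsistentAlong D P T u ε η N) (hT : 0 ≤ T) {G : ℝ} (hG0 : 0 ≤ G) (i : ι) (hη : 0 ≤ η i)
    {k : ℝ} (hk : 0 < k)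
    (hG : ∀ n : ℕ, n * k ≤ T → ‖k • ((D i).Ah * ∑ r ∈ Finset.Icc 1 (n - 1),
      NormedSpace.exp ((r * k) • (D i).Ah))‖ ≤ G) {n : ℕ} (hn : n * k ≤ T) :
    ‖∑ m ∈ Finset.range n, (NormedSpace.exp (k • (D i).Ah) ^ (n - 1 - m))
      ((D i).leadingError P u f₂ k (m * k))‖
      ≤ (1 + T) * (2 * (M + N) + 2 * ((2 + G) * M)) * (k ^ 2 + η i) := by
  have hexp := hD.contractive i
  have hM := hE.nonneg
  have hN0 := hN.nonneg
  set e := NormedSpace.exp (k • (D i).Ah) with he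
  set J₁ := k ^ 1 • phiOp 1 k (D i).Ah with hJ₁
  set J₂ := k ^ 2 • phiOp 2 k (D i).Ah with hJ₂
  set J₃ := k ^ 3 • phiOp 3 k (D i).Ah with hJ₃
  have nJ1 : ‖J₁‖ ≤ k := 
    (norm_pow_smul_phiOp_le le_rfl hk hexp).trans_eq (pow_one k)
  have nJ2 : ‖J₂‖ ≤ k ^ 2 := norm_pow_smul_phiOp_le (by norm_num) hk hexp
  have nJ3 : ‖J₃‖ ≤ k ^ 3 := norm_pow_smul_phiOp_le (by norm_num) hk hexp
  have n1 : ‖(1 : (D i).E →L[ℂ] (D i).E)‖ ≤ 1 :=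
    ContinuousLinearMap.norm_id_le
  have nk : ∀ c : ℝ, 0 ≤ c → ‖c • (1 : (D i).E →L[ℂ] (D i).E)‖ ≤ c := fun c hc => by
    rw [norm_smul, Real.norm_of_nonneg hc]
    exact mul_le_of_le_one_right hc n1
  have hmn : ∀ m ≤ n, (m : ℝ) * k ≤ T := fun m hm =>
    (mul_le_mul_of_nonneg_right (by exact_mod_cast hm) hk.le).trans hn
  have hI : ∀ m ≤ n, (m : ℝ) * k ∈ Icc 0 T := fun m hm => ⟨by positivity, hmn m hm⟩
  have hdiff : ∀ m : ℕ, |((m + 1 : ℕ) : ℝ) * k - m * k| = k := fun m => by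
    rw [show ((m + 1 : ℕ) : ℝ) * k - m * k = k by push_cast; ring, abs_of_pos hk]
  -- the three operators
  set Q₂ : (D i).E →L[ℂ] (D i).E := k • (1 : (D i).E →L[ℂ] (D i).E) - J₁ with hQ₂
  set Q₃ : (D i).E →L[ℂ] (D i).E := (k ^ 2 / 2) • (1 : (D i).E →L[ℂ] (D i).E) - J₂ with hQ₃
  have hS₁ : ∀ m ≤ n, ‖∑ r ∈ Finset.range m, e ^ r * (1 - e)‖ ≤ 2 := fun m _ =>
    norm_sum_exp_mul_one_sub_le hk hexp m
  -- The partial sums are no larger in order than one term: `Q₂` is minus B times k²φ₂, so Q' = k⁻¹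
  -- • J₂ has norm at most k. In the same way J₃ gives k² for `Q₃`.
  have hS₂ : ∀ m ≤ n, ‖∑ r ∈ Finset.range m, e ^ r * Q₂‖ ≤ 2 * k + G * k := by
    intro m hm
    refine norm_sum_exp_mul_le hG hT (Q' := k⁻¹ • J₂) ?_ ?_ ?_ m (hmn m hm)
    · rw [mul_smul_comm, smul_smul, mul_inv_cancel₀ hk.ne', one_smul, hJ₂,
        commute_pow_smul_phiOp 2 hk, phiOp_succ_mul le_rfl hk, hQ₂]
      simp only [pow_one, Nat.factorial_one, Nat.cast_one, div_one, hJ₁]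
      abel
    · refine (norm_sub_le _ _).trans ?_
      linarith [nk k hk.le]
    · rw [norm_smul, norm_inv, Real.norm_of_nonneg hk.le, inv_mul_le_iff₀ hk]
      exact nJ2.trans_eq (by ring)
  have hS₃ : ∀ m ≤ n, ‖∑ r ∈ Finset.range m, e ^ r * Q₃‖ ≤ 2 * k ^ 2 + G * k ^ 2 := by
    intro m hm
    refine norm_sum_exp_mul_le hG hT (Q' := k⁻¹ • J₃) ?_ ?_ ?_ m (hmn m hm)
    · rw [mul_smul_comm, smul_smul, mul_inv_cancel₀ hk.ne', one_smul, hJ₃,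
        commute_pow_smul_phiOp 3 hk, phiOp_succ_mul (by norm_num) hk, hQ₃]
      simp only [Nat.factorial_two, Nat.cast_ofNat, hJ₂]
      abel
    · refine (norm_sub_le _ _).trans ?_
      have := nk (k ^ 2 / 2) (by positivity)
      nlinarith [sq_nonneg k]
    · rw [norm_smul, norm_inv, Real.norm_of_nonneg hk.le, inv_mul_le_iff₀ hk]
      exact nJ3.trans_eq (by ring)
  -- the three sums
  set ψ₁ : ℕ → (D i).E := fun m =>
    -((k ^ 2 / 8) • (D i).projL (f₂ (m * k)) + (D i).ellErr P (u (m * k))) with hψ₁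
  set ψ₂ : ℕ → (D i).E := fun m =>
    -((k / 2) • (D i).projL (P.app (P.f (m * k) (u (m * k))))) with hψ₂
  set ψ₃ : ℕ → (D i).E := fun m => -((D i).projL (P.app (P.app (u (m * k))))) with hψ₃
  have hbd := hE.bound _ (hI 0 (Nat.zero_le n))
  have hnp := (D i).norm_projL_le
  have b₁ := norm_sum_pow_mul_le e (1 - e) n ψ₁ (G := 2) (c := k ^ 2 * M + η i * N)
    (d := (k ^ 2 * M + η i * N) * k) (by norm_num) hS₁
    (by
      rw [hψ₁, norm_neg]
      refine (norm_add_le _ _).trans (add_le_add ?_ (hN.eta i _ (hI 0 (Nat.zero_le n))))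
      rw [norm_smul, Real.norm_of_nonneg (by positivity)]
      exact mul_le_mul (by nlinarith [sq_nonneg k]) ((hnp _).trans hbd.2.2.2.2.2.1)
        (norm_nonneg _) (by positivity))
    (fun m hm => by
      have h1 := (hE.lipschitz _ (hI m hm.le) _ (hI (m + 1) hm)).2.2.2
      have h2 := hN.eta_lipschitz i _ (hI m hm.le) _ (hI (m + 1) hm)
      rw [hdiff] at h1 h2
      have e1 : ψ₁ (m + 1) - ψ₁ m = -((k ^ 2 / 8) • (D i).projL
          (f₂ (((m + 1 : ℕ) : ℝ) * k) - f₂ (m * k)) + ((D i).ellErr P (u (((m + 1 : ℕ) : ℝ) * k))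
            - (D i).ellErr P (u (m * k)))) := by
        simp only [hψ₁, map_sub, smul_sub]
        abel
      rw [e1, norm_neg]
      refine (norm_add_le _ _).trans ((add_le_add ?_ h2).trans_eq (by ring :
        k ^ 2 * (M * k) + η i * (N * k) = _))
      rw [norm_smul, Real.norm_of_nonneg (by positivity)]
      exact mul_le_mul (by nlinarith [sq_nonneg k]) ((hnp _).trans h1)
        (norm_nonneg _) (by positivity))
  have b₂ := norm_sum_pow_mul_le e Q₂ n ψ₂ (G := 2 * k + G * k) (c := k * M)
    (d := k * (M * k)) (by positivity) hS₂
    (by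
      rw [hψ₂, norm_neg, norm_smul, Real.norm_of_nonneg (by positivity)]
      exact mul_le_mul (by linarith) ((hnp _).trans hbd.2.2.2.2.1) (norm_nonneg _) hk.le)
    (fun m hm => by
      have h1 := (hE.lipschitz _ (hI m hm.le) _ (hI (m + 1) hm)).2.2.1
      rw [hdiff] at h1
      have e1 : ψ₂ (m + 1) - ψ₂ m = -((k / 2) • (D i).projL
          (P.app (P.f (((m + 1 : ℕ) : ℝ) * k) (u (((m + 1 : ℕ) : ℝ) * k)))
            - P.app (P.f (m * k) (u (m * k))))) := by
        simp only [hψ₂, map_sub, smul_sub]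
        abel
      rw [e1, norm_neg, norm_smul, Real.norm_of_nonneg (by positivity)]
      exact mul_le_mul (by linarith) ((hnp _).trans h1) (norm_nonneg _) hk.le)
  have b₃ := norm_sum_pow_mul_le e Q₃ n ψ₃ (G := 2 * k ^ 2 + G * k ^ 2) (c := M)
    (d := M * k) (by positivity) hS₃
    (by
      rw [hψ₃, norm_neg]
      exact (hnp _).trans hbd.2.2.2.1)
    (fun m hm => by
      have h1 := (hE.lipschitz _ (hI m hm.le) _ (hI (m + 1) hm)).2.1
      rw [hdiff] at h1
      have e1 : ψ₃ (m + 1) - ψ₃ m = -((D i).projL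
          (P.app (P.app (u (((m + 1 : ℕ) : ℝ) * k))) - P.app (P.app (u (m * k))))) := by
        simp only [hψ₃, map_sub]
        abel
      rw [e1, norm_neg]
      exact (hnp _).trans h1)
  have hsplit : ∑ m ∈ Finset.range n, (e ^ (n - 1 - m)) ((D i).leadingError P u f₂ k (m * k))
      = ∑ m ∈ Finset.range n, (e ^ (n - 1 - m) * (1 - e)) (ψ₁ m)
        + ∑ m ∈ Finset.range n, (e ^ (n - 1 - m) * Q₂) (ψ₂ m)
        + ∑ m ∈ Finset.range n, (e ^ (n - 1 - m) * Q₃) (ψ₃ m) := by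
    rw [← Finset.sum_add_distrib, ← Finset.sum_add_distrib]
    refine Finset.sum_congr rfl fun m _ => ?_
    have : (D i).leadingError P u f₂ k (m * k) = (1 - e) (ψ₁ m) + Q₂ (ψ₂ m) + Q₃ (ψ₃ m) := rfl
    rw [this, map_add, map_add]
    rfl
  rw [hsplit]
  have hnk : ∀ c : ℝ, 0 ≤ c → c + n * (c * k) ≤ (1 + T) * c := fun c hc => by
    nlinarith [mul_le_mul_of_nonneg_left hn hc]
  have c₁ := mul_le_mul_of_nonneg_left (hnk (k ^ 2 * M + η i * N) (by positivity)) zero_le_two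
  have c₂ := mul_le_mul_of_nonneg_left (hnk (k * M) (by positivity))
    (by positivity : 0 ≤ 2 * k + G * k)
  have c₃ := mul_le_mul_of_nonneg_left (hnk M hM) (by positivity : 0 ≤ 2 * k ^ 2 + G * k ^ 2)
  rw [show k * M * k = k * (M * k) by ring] at c₂
  refine (norm_add_le _ _).trans ((add_le_add ((norm_add_le _ _).trans (add_le_add
    (b₁.trans c₁) (b₂.trans c₂))) (b₃.trans c₃)).trans ?_)
  have d₁ : 0 ≤ (1 + T) * (2 * (M * η i)) := by positivity
  have d₂ : 0 ≤ (1 + T) * (2 * (N * k ^ 2)) := by positivity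
  have d₃ : 0 ≤ (1 + T) * (2 * ((2 + G) * M) * η i) := by positivity
  nlinarith

/-- The error bound on `[0, T]` from the local errors, as long as the numerical solution stays near
the exact one. -/
theorem norm_recursion_le {E : Type*} [NormedAddCommGroup E] [NormedSpace ℂ E]
    {e : E →L[ℂ] E} (he : ∀ m : ℕ, ‖e ^ m‖ ≤ 1) {x y : ℕ → E} (h0 : x 0 = 0) {n : ℕ}
    {k T C b A : ℝ} (hk : 0 < k) (hn : n * k ≤ T) (hC : 0 ≤ C) (hb : 0 ≤ b)
    (hx : ∀ m < n, ‖x (m + 1) - (e (x m) + y m)‖ ≤ C * (k * b + k * ‖x m‖))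
    (hy : ∀ m ≤ n, ‖∑ l ∈ Finset.range m, (e ^ (m - 1 - l)) (y l)‖ ≤ A) :
    ‖x n‖ ≤ (A + C * T * b) * Real.exp (C * T) := by
  have hA : 0 ≤ A := by simpa using hy 0 (Nat.zero_le n)
  have hT : 0 ≤ T := le_trans (by positivity) hn
  have hstep : ∀ m ≤ n, ‖x m‖ ≤ (A + C * T * b) + C * k * ∑ l ∈ Finset.range m, ‖x l‖ := by
    intro m hm
    -- The recursion is made exact with the defect as part of the inhomogeneity. The defect is then
    -- summed in norm, while the sums of `y` use the cancellation in `hy`.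
    have h1 := recursion_eq_sum e x (fun l => (x (l + 1) - (e (x l) + y l)) + y l) h0 m
      (fun l _ => by abel)
    simp only [map_add, Finset.sum_add_distrib] at h1
    have h2 : ‖∑ l ∈ Finset.range m, (e ^ (m - 1 - l)) (x (l + 1) - (e (x l) + y l))‖
        ≤ ∑ l ∈ Finset.range m, C * (k * b + k * ‖x l‖) := by
      refine norm_sum_le_of_le _ fun l hl => ?_
      have hl' : l < n := (Finset.mem_range.1 hl).trans_le hm
      refine ((e ^ (m - 1 - l)).le_of_opNorm_le (he _) _).trans ?_
      rw [one_mul]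
      exact hx l hl'
    have h3 : ∑ l ∈ Finset.range m, C * (k * b + k * ‖x l‖)
        = C * (m * k) * b + C * k * ∑ l ∈ Finset.range m, ‖x l‖ := by
      rw [← Finset.mul_sum, Finset.sum_add_distrib, Finset.sum_const, Finset.card_range,
        nsmul_eq_mul, ← Finset.mul_sum]
      ring
    have h4 : (m : ℝ) * k ≤ T :=
      (mul_le_mul_of_nonneg_right (by exact_mod_cast hm) hk.le).trans hn
    have h5 : C * (m * k) * b ≤ C * T * b :=
      mul_le_mul_of_nonneg_right (mul_le_mul_of_nonneg_left h4 hC) hb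
    have h6 := hy m hm
    rw [h1]
    refine (norm_add_le _ _).trans ?_
    linarith
  have h7 := le_mul_one_add_pow_of_le_sum (by positivity) n hstep n le_rfl
  refine h7.trans (mul_le_mul_of_nonneg_left ?_ (by positivity))
  calc (1 + C * k) ^ n ≤ Real.exp (C * k) ^ n :=
        pow_le_pow_left₀ (by positivity) (by linarith [Real.add_one_le_exp (C * k)]) n
    _ = Real.exp (n * (C * k)) := (Real.exp_nat_mul _ _).symm
    _ ≤ Real.exp (C * T) := Real.exp_le_exp.2 (by nlinarith)

end SpaceDisc

/-! ### Control of the boundary correction and smallness conditions on k and h -/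

namespace SpaceDisc

variable {K : Type*} [TopologicalSpace K] [CompactSpace K]
  {Y : Type*} [NormedAddCommGroup Y] [NormedSpace ℂ Y] {ι : Type*}

/-- In both cases the error in the boundary values of the source term is controlled. -/
theorem exists_boundary_bound {D : ι → SpaceDisc K Y} {P : IBVP K Y} {T : ℝ} {u : ℝ → C(K, ℂ)}
    {Ψ : ∀ i, ℝ → ℝ → (D i).E → (D i).E} {Cs : ∀ i, ℝ → (D i).E → (D i).E}
    (h : BoundaryExact D P T u Cs ∨ BoundaryApprox D P T u Ψ Cs) :
    ∃ r c : ℝ, 0 < r ∧ 0 ≤ c ∧ ∀ i, ∀ k : ℝ, 0 < k → ∀ n : ℕ, n * k ≤ T →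
      ‖(D i).strangSol P T (Ψ i) (Cs i) k n - (D i).projL (u (n * k))‖ ≤ r →
      ‖Ring.inverse (D i).Ah (Cs i (n * k) ((D i).strangSol P T (Ψ i) (Cs i) k n)
          - (D i).Ch (P.bdry (P.f (n * k) (u (n * k)))))‖
        ≤ c * ‖(D i).strangSol P T (Ψ i) (Cs i) k n - (D i).projL (u (n * k))‖ := by
  rcases h with h | ⟨r, C, hr, h⟩
  · refine ⟨1, 0, one_pos, le_rfl, fun i k hk n hn _ => ?_⟩
    rw [h i _ ⟨by positivity, hn⟩, sub_self, map_zero, norm_zero, zero_mul]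
  · refine ⟨r, |C|, hr, abs_nonneg C, fun i k hk n hn hle => (h i k hk n hn hle).trans ?_⟩
    exact mul_le_mul_of_nonneg_right (le_abs_self C) (norm_nonneg _)

theorem exists_small_of_tendsto {h f : ι → ℝ} (hh : ∀ i, 0 < h i)
    (hf : Tendsto f (comap h (𝓝 0)) (𝓝 0)) {δ : ℝ} (hδ : 0 < δ) :
    ∃ h₀ : ℝ, 0 < h₀ ∧ ∀ i, h i ≤ h₀ → f i ≤ δ := by
  have h1 := hf.eventually (eventually_lt_nhds hδ)
  rw [eventually_comap, Metric.eventually_nhds_iff] at h1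
  obtain ⟨ρ, hρ, h2⟩ := h1
  refine ⟨ρ / 2, by positivity, fun i hi => (h2 (y := h i) ?_ i rfl).le⟩
  rw [Real.dist_eq, sub_zero, abs_of_pos (hh i)]
  linarith

/-- Half of r is spent on 2k ≥ k² + kε and half on η; c + 1 replaces c so that the thresholds can be
formed by division. -/
theorem mul_error_le_of_small {c r k ε η : ℝ} (hc : 0 ≤ c) (hk : 0 < k) (hk1 : k ≤ 1)
    (hε : ε ≤ 1) (hη : 0 ≤ η) (hkr : k * (4 * (c + 1)) ≤ r) (hηr : η * (2 * (c + 1)) ≤ r) :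
    c * (k ^ 2 + k * ε + η) ≤ r := by
  have hkk : k ^ 2 ≤ k := by nlinarith
  have hkε : k * ε ≤ k := mul_le_of_le_one_right hk.le hε
  calc c * (k ^ 2 + k * ε + η) ≤ c * (2 * k + η) := mul_le_mul_of_nonneg_left (by linarith) hc
    _ ≤ (c + 1) * (2 * k + η) := mul_le_mul_of_nonneg_right (by linarith) (by positivity)
    _ ≤ r := by linarith

theorem five_mul_le {R M r k : ℝ} (hR : 0 ≤ R) (hM : 0 ≤ M) (hk : 0 < k)
    (hkr : k * (3 * (6 * M + 2 * R + 1)) ≤ r) : 5 * M * k ≤ r := by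
  have h1 : 0 ≤ M * k := by positivity
  have h2 : 0 ≤ R * k := by positivity
  linarith

/-- A third of r is reserved for each of k, η and the current error b. The left-hand side is the
radius condition of `norm_local_error_le`. -/
theorem step_radius_le {R M N r k ε η b : ℝ} (hR : 0 ≤ R) (hM : 0 ≤ M) (hN : 0 ≤ N) (hk : 0 < k)
    (hk1 : k ≤ 1) (hε0 : 0 ≤ ε) (hε : ε ≤ 1) (hη : 0 ≤ η) (hb : 0 ≤ b)
    (hkr : k * (3 * (6 * M + 2 * R + 1)) ≤ r) (hηr : η * (3 * (2 * N + R + 1)) ≤ r)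
    (hbr : b * (3 * (1 + R)) ≤ r) :
    b + R * (k ^ 3 + k ^ 2 * ε + k * η + k * b) + 3 * M * k ^ 2 + 2 * N * η + 3 * M * k ≤ r := by
  have hkk : k ^ 2 ≤ k := by nlinarith
  have hkε : k * ε ≤ k := mul_le_of_le_one_right hk.le hε
  have hX : k ^ 3 + k ^ 2 * ε + k * η + k * b ≤ 2 * k + η + b := by
    have h1 : k * (k ^ 2 + k * ε + η + b) ≤ k ^ 2 + k * ε + η + b :=
      mul_le_of_le_one_left (by positivity) hk1
    linarith
  have hRX := mul_le_mul_of_nonneg_left hX hR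
  have hMk := mul_le_mul_of_nonneg_left hkk hM
  have hMk0 : 0 ≤ M * k := by positivity
  have hRk0 : 0 ≤ R * k := by positivity
  have hNη0 : 0 ≤ N * η := by positivity
  have hRη0 : 0 ≤ R * η := by positivity
  linarith

end SpaceDisc

/-! ### The convergence theorem -/

set_option maxHeartbeats 1000000 in
theorem mainTheorem1
    {K : Type*} [TopologicalSpace K] [CompactSpace K]
    {Y : Type*} [NormedAddCommGroup Y] [NormedSpace ℂ Y] [CompleteSpace Y]
    {Z : Type*} [NormedAddCommGroup Z] [NormedSpace ℂ Z]
    {ι : Type*}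
    -- the problem, its solution, the semigroup generated by `A₀` and its type
    (P : IBVP K Y) (T : ℝ) (hT : 0 < T) (u : ℝ → C(K, ℂ)) (hu : P.IsSolution T u)
    (S : ℝ → C(K, ℂ) →L[ℂ] C(K, ℂ)) (ω : ℝ) (hA : P.StandingHyp T u S ω)
    -- the space discretizations, their mesh sizes and the consistency bounds
    (D : ι → SpaceDisc K Y) (h : ι → ℝ) (hh : ∀ i, 0 < h i)
    (j : Z →ₗ[ℂ] C(K, ℂ)) (ε η : ι → ℝ) (hε : ∀ i, 0 ≤ ε i) (hη : ∀ i, 0 ≤ η i)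
    (hε_small : Tendsto ε (comap h (𝓝 0)) (𝓝 0)) (hη_small : Tendsto η (comap h (𝓝 0)) (𝓝 0))
    (h1 : SpaceDisc.Stable D) (h2 : SpaceDisc.Consistent D P S j ε η) (h3 : SpaceDisc.SourceHyp D P T u)
    -- the integrator of the nonlinear part
    (Ψ : ∀ i, ℝ → ℝ → (D i).E → (D i).E) (p : ℕ) (hp : 2 ≤ p)
    (hΨ : SpaceDisc.HasOrder D T u Ψ p)
    -- summation by parts and the extra regularity
    (hspp : SpaceDisc.SummationByParts D T)
    (hreg : P.ExtraRegularity T u) (hregZ : P.ExtraRegularityZ T u j)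
    -- the values used for `C_h ∂f(t_n, u(t_n))`
    (Cs : ∀ i, ℝ → (D i).E → (D i).E)
    (hCs : SpaceDisc.BoundaryExact D P T u Cs ∨ SpaceDisc.BoundaryApprox D P T u Ψ Cs) :
    ∃ C k₀ h₀ : ℝ, 0 < k₀ ∧ 0 < h₀ ∧
      ∀ i, h i ≤ h₀ → ∀ k : ℝ, 0 < k → k ≤ k₀ → ∀ n : ℕ, n * k ≤ T →
        ‖(D i).proj (u (n * k)) - (D i).strangSol P T (Ψ i) (Cs i) k n‖
          ≤ C * (k ^ 2 + k * ε i + η i) := by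
  obtain ⟨hg, f₂, q, M, k₁, hE⟩ := IBVP.exists_expansion hT hu hA hreg
  obtain ⟨N, hN⟩ := h2.exists_along hε hη hT hregZ
  obtain ⟨r, τ₀, C, hr, hτ₀, hC, hH⟩ := SpaceDisc.exists_halfStep_bound h3 hp hΨ
    (fun t ht s hs => (hE.lipschitz t ht s hs).1) (fun t ht => (hE.bound t ht).2.2.1)
  obtain ⟨r', c, hr', hc, hbc⟩ := SpaceDisc.exists_boundary_bound hCs
  obtain ⟨G₀, hG₀⟩ := hspp
  have hM := hE.nonneg
  have hN0 := hN.nonneg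
  have hk₁ := hE.pos
  set G := |G₀| with hG
  have hG0 : 0 ≤ G := abs_nonneg _
  set R := C + C * (M + 1) + 2 * N + 3 * c with hR
  have hR0 : 0 ≤ R := by positivity
  set L := R + C * (R + 4 * M + 2 + 2 * N) + M with hL
  have hL0 : 0 ≤ L := by positivity
  set A := (1 + T) * (2 * (M + N) + 2 * ((2 + G) * M)) with hAdef
  have hA0 : 0 ≤ A := by positivity
  set Cf := (A + L * T) * Real.exp (L * T) with hCf
  have hCf0 : 0 ≤ Cf := by positivity
  -- the neighbourhood in which the numerical solution stays and the smallness of the parameters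
  set r₀ := min r' (r / (3 * (1 + R))) with hr₀
  have hr₀0 : 0 < r₀ := lt_min hr' (by positivity)
  set κ := min (min (min k₁ 1) τ₀) (min (r / (3 * (6 * M + 2 * R + 1))) (r₀ / (4 * (Cf + 1))))
    with hκ
  have hκ0 : 0 < κ := by
    refine lt_min (lt_min (lt_min hk₁ one_pos) hτ₀) (lt_min ?_ ?_) <;> positivity
  set s₀ := min (r / (3 * (2 * N + R + 1))) (r₀ / (2 * (Cf + 1))) with hs₀
  have hs₀0 : 0 < s₀ := lt_min (by positivity) (by positivity)
  obtain ⟨h₁, hh₁, hεh⟩ := SpaceDisc.exists_small_of_tendsto hh hε_small one_pos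
  obtain ⟨h₂, hh₂, hηh⟩ := SpaceDisc.exists_small_of_tendsto hh hη_small hs₀0
  refine ⟨Cf, κ, min h₁ h₂, hκ0, lt_min hh₁ hh₂, fun i hi k hk hkκ => ?_⟩
  have hε1 := hεh i (hi.trans (min_le_left _ _))
  have hηs := hηh i (hi.trans (min_le_right _ _))
  have hεi := hε i
  have hηi := hη i
  simp only [hκ, le_min_iff] at hkκ
  obtain ⟨⟨⟨ka, kb⟩, kc⟩, kd, ke⟩ := hkκ
  simp only [hs₀, le_min_iff] at hηs
  obtain ⟨sa, sb⟩ := hηs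
  rw [le_div_iff₀ (by positivity)] at kd ke sa sb
  set X := k ^ 2 + k * ε i + η i with hX
  have hX0 : 0 ≤ X := by positivity
  have hXr : Cf * X ≤ r₀ := SpaceDisc.mul_error_le_of_small hCf0 hk kb hε1 hηi ke sb
  set x : ℕ → (D i).E := fun n =>
    (D i).strangSol P T (Ψ i) (Cs i) k n - (D i).projL (u (n * k)) with hx
  have hx0 : x 0 = 0 := by
    simp only [hx, Nat.cast_zero, zero_mul]
    rw [hu.initial]
    exact sub_self _
  -- For m < n the inductive bound and Cf·X ≤ r₀ make the local estimate available at step m. The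
  -- recursion is then summed afresh from 0, so `Cf` does not grow with n.
  have key : ∀ n : ℕ, n * k ≤ T → ‖x n‖ ≤ Cf * X := by
    intro n
    induction n using Nat.strong_induction_on with
    | _ n ih =>
      intro hn
      have hmn : ∀ m ≤ n, (m : ℝ) * k ≤ T := fun m hm =>
        (mul_le_mul_of_nonneg_right (by exact_mod_cast hm) hk.le).trans hn
      have hG' : ∀ n : ℕ, n * k ≤ T → ‖k • ((D i).Ah * ∑ r ∈ Finset.Icc 1 (n - 1),
          NormedSpace.exp ((r * k) • (D i).Ah))‖ ≤ G := fun n hn =>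
        (hG₀ i k hk n hn).trans (le_abs_self _)
      have hfin := SpaceDisc.norm_recursion_le (e := NormedSpace.exp (k • (D i).Ah)) (x := x)
        (y := fun m => (D i).leadingError P u f₂ k (m * k)) (n := n) (k := k) (T := T) (C := L)
        (b := X) (A := A * X) (fun m => by
          rw [← exp_nat_mul_smul]
          exact h1.contractive i _ (by positivity)) hx0 hk hn hL0 hX0 (fun m hm => ?_)
        (fun m hm => ?_)
      · refine hfin.trans_eq ?_
        rw [hCf]; ring
      · have hmr : ‖x m‖ ≤ r₀ := (ih m hm (hmn m hm.le)).trans hXr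
        have hmr1 := hmr.trans (min_le_left _ _)
        have hmr2 := hmr.trans (min_le_right _ _)
        rw [le_div_iff₀ (by positivity)] at hmr2
        have hm1 : ((m + 1 : ℕ) : ℝ) * k = m * k + k := by push_cast; ring
        set X' := k ^ 3 + k ^ 2 * ε i + k * η i + k * ‖x m‖ with hX'
        have hX'e : X' = k * X + k * ‖x m‖ := by rw [hX', hX]; ring
        have hloc := SpaceDisc.norm_local_error_le hE hu.boundary hg h1 hH hC hN hc hR i hεi hηi
          (t := m * k) (by positivity) hk (by rw [← hm1]; exact hmn (m + 1) hm) ka kb kc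
          (SpaceDisc.five_mul_le hR0 hM hk kd) (Cs i) (hbc i k hk m (hmn m hm.le) hmr1) hX' (by
            show ‖x m‖ + R * X' + 3 * M * k ^ 2 + 2 * N * η i + 3 * M * k ≤ r
            exact SpaceDisc.step_radius_le hR0 hM hN0 hk kb hεi hε1 hηi (norm_nonneg _) kd sa hmr2)
        have e3 : x (m + 1) = (D i).strangStep P T (Ψ i) (Cs i) k (m * k)
            ((D i).strangSol P T (Ψ i) (Cs i) k m) - (D i).projL (u (m * k + k)) := by
          simp only [hx, hm1]
          rfl
        rw [e3, ← hX'e]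
        exact hloc
      · refine (SpaceDisc.norm_sum_leadingError_le hE h1 hN hT.le hG0 i hηi hk hG'
          (hmn m hm)).trans ?_
        exact mul_le_mul_of_nonneg_left (by linarith [mul_nonneg hk.le hεi]) hA0
  intro n hn
  rw [norm_sub_rev]
  exact key n hn
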